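/- Let $\lambda>0$, $\alpha>2$, $R>0$, $T>0$ and $\sigma^2\ge 0$. Base stations (BSs) form a homogeneous Poisson point process $\Phi$ of intensity $\lambda$ in $\mathbb{R}^2$. The cooperating cluster is the disc $D_c=\mathcal{B}(O,R)$ around the origin $O$. A typical user $u$ is uniformly distributed in $D_c$, the fading coefficients $h_y$ ($y\in\Phi$) between the BSs and the user are i.i.d. $\mathcal{CN}(0,1)$, and $\Phi$, $u$ and the fading are independent. The user is served by its nearest BS $b\in\Phi$, which need not lie in $D_c$. Write $r_u=\|u\|$ and $r_b=\|b-u\|$; these are independent, with densities $2r/R^2$ on $[0,R]$ and $2\pi\lambda r e^{-\lambda\pi r^2}$ on $[0,\infty)$ respectively. Zero-forcing dirty paper coding cancels the interference from the BSs in $D_c$, and with the approximation $l_{ii}\approx h_{ii}r_{ii}^{-\alpha/2}$ of the effective channel coefficient the signal-to-interference-plus-noise ratio is $$\mathtt{SINR}=\frac{|h_b|^2 r_b^{-\alpha}}{\sigma^2+\sum_{y\in\Phi\setminus(D_c\cup\{b\})}|h_y|^2\|y-u\|^{-\alpha}} .$$ Then the coverage probability $P_{c,R}(T)=\mathbb{P}[\mathtt{SINR}>T]$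 satisfies $$P_{c,R}(T)\ \ge\ \mathbb{E}_{r_u,r_b}\big[P_1(T)\mathbf{1}(r_b<R-r_u)\big]+\mathbb{E}_{r_u,r_b}\big[P_2(T)\mathbf{1}(R-r_u<r_b<R+r_u)\big],$$ where $$P_1(T)=e^{-Tr_b^\alpha\sigma^2}\exp\Big(-\lambda\int_0^{2\pi}\frac{T r_b^\alpha (R')^{2-\alpha}\Lambda(r_b/R',T)}{\alpha-2}\,\mathrm{d}\varphi\Big),$$ $$P_2(T)=e^{-Tr_b^\alpha\sigma^2}\exp\Big(-2\lambda\Theta\,\frac{T r_b^2\Lambda(1,T)}{\alpha-2}\Big)\exp\Big(-\lambda\int_{\Theta}^{2\pi-\Theta}\frac{T r_b^\alpha (R')^{2-\alpha}\Lambda(r_b/R',T)}{\alpha-2}\,\mathrm{d}\varphi\Big),$$ with $$\Lambda(\rho,T)={}_2F_1\Big(1,\tfrac{\alpha-2}{\alpha};2-\tfrac{2}{\alpha};-\rho^\alpha T\Big),\qquad R'=R'(\varphi)=\sqrt{\cos^2(\varphi)\,r_u^2-r_u^2+R^2}-\cos(\varphi)\,r_u,$$ $$\Theta=\pi-\arccos\Big[\frac{r_b^2+r_u^2-R^2}{2r_br_u}\Big],$$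 where ${}_2F_1$ is the Gauss hypergeometric function, analytically continued to $(-\infty,1)$. -/

import Mathlib

open MeasureTheory ProbabilityTheory Set
open scoped ENNReal NNReal

noncomputable section

namespace CloudRadio

/-! ### The Poisson network -/

/-- The Euclidean plane in which base stations (BSs) and users live. -/
abbrev Plane : Type := EuclideanSpace ℝ (Fin 2)

/-- The number of indices `n` for which the random point `X n` lies in `A`. -/
def pointCount {Ω : Type*} (X : ℕ → Ω → Plane) (A : Set Plane) (ω : Ω) : ℕ∞ :=
  {n : ℕ | X n ω ∈ A}.encard

/-- `X 0, X 1, …` is a measurable enumeration of the points of a homogeneous spatial Poisson point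
process of intensity `lam > 0` in the plane: the number of points in a Borel set of finite area
`a` has the Poisson law with parameter `lam * a`, and the numbers of points in pairwise disjoint
Borel sets are independent. (For `lam > 0` the process almost surely has infinitely many points
and no multiple points, so that an enumeration by `ℕ` is no restriction.) -/
structure IsPoissonProcess {Ω : Type*} [MeasurableSpace Ω] (P : Measure Ω) (lam : ℝ)
    (X : ℕ → Ω → Plane) : Prop where
  measurable : ∀ n, Measurable (X n)
  count_law : ∀ A : Set Plane, MeasurableSet A → volume A ≠ ∞ → ∀ k : ℕ,
    P {ω | pointCount X A ω = k} =
      ENNReal.ofReal (Real.exp (-(lam * volume.real A)) * (lam * volume.real A) ^ k / (k.factorial : ℝ))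
  count_indep : ∀ (m : ℕ) (A : Fin m → Set Plane), (∀ i, MeasurableSet (A i)) →
    Pairwise (fun i j => Disjoint (A i) (A j)) → iIndepFun (fun i => pointCount X (A i)) P

/-- The circularly symmetric complex Gaussian law `𝒞𝒩(0,1)`: real and imaginary part are independent
centred real Gaussians of variance `1/2`. -/
def complexGaussian : Measure ℂ :=
  ((gaussianReal 0 (1 / 2)).prod (gaussianReal 0 (1 / 2))).map (fun p : ℝ × ℝ => (⟨p.1, p.2⟩ : ℂ))

/-- The disc `B(O, R)` that represents the cooperating cluster. -/
def cluster (R : ℝ) : Set Plane := Metric.closedBall 0 R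

/-! ### A realization of the network

Below, `x n` is the location of the `n`-th BS, `h n` the fading coefficient between it and the
typical user, and `u` the location of the typical user. -/

/-- The power received at `u` from the `n`-th BS, `|hₙ|² ‖xₙ - u‖ ^ (-α)`. -/
def rxPower (α : ℝ) (x : ℕ → Plane) (h : ℕ → ℂ) (u : Plane) (n : ℕ) : ℝ≥0∞ :=
  ENNReal.ofReal (‖h n‖ ^ 2 * ‖x n - u‖ ^ (-α))

/-- Nearest-BS connectivity: the user at `u` is served by the `n`-th BS. -/
def IsServing (x : ℕ → Plane) (u : Plane) (n : ℕ) : Prop :=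
  ∀ k, k ≠ n → ‖x n - u‖ < ‖x k - u‖

open Classical in
/-- The residual interference at `u` when the serving BS is the `n`-th one: the power received from
all the BSs outside the cluster other than the serving BS. -/
def interference (α R : ℝ) (x : ℕ → Plane) (h : ℕ → ℂ) (u : Plane) (n : ℕ) : ℝ≥0∞ :=
  ∑' k, if k ≠ n ∧ x k ∉ cluster R then rxPower α x h u k else 0

/-- The post-processing signal-to-interference-plus-noise ratio of the user at `u` when it is served
by the `n`-th BS, for noise variance `σ ^ 2`. Zero-forcing dirty paper coding has removed the
interference from within the cluster, and the useful signal `|lᵢᵢ|²` is approximated by the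
power `|hₙ|² ‖xₙ - u‖ ^ (-α)` received from the serving BS. -/
def sinr (α R σ : ℝ) (x : ℕ → Plane) (h : ℕ → ℂ) (u : Plane) (n : ℕ) : ℝ≥0∞ :=
  rxPower α x h u n / (ENNReal.ofReal (σ ^ 2) + interference α R x h u n)

/-- The user at `u` is in coverage: its SINR, with respect to the BS that serves it, is above the
threshold `T`. -/
def InCoverage (α R σ T : ℝ) (x : ℕ → Plane) (h : ℕ → ℂ) (u : Plane) : Prop :=
  ∃ n, IsServing x u n ∧ ENNReal.ofReal T < sinr α R σ x h u n

/-- `r_b`: the distance of the user at `u` to its closest BS. -/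
def nearestDist (x : ℕ → Plane) (u : Plane) : ℝ := ⨅ n, ‖x n - u‖

/-- The law with density `2 r / R²` on `[0, R]`. -/
def userDistLaw (R : ℝ) : Measure ℝ :=
  volume.withDensity ((Icc 0 R).indicator fun r => ENNReal.ofReal (2 * r / R ^ 2))

/-- The law with density `2 π lam r exp (-lam π r²)` on `[0, ∞)`. -/
def nearestDistLaw (lam : ℝ) : Measure ℝ :=
  volume.withDensity
    ((Ici 0).indicator fun r =>
      ENNReal.ofReal (2 * Real.pi * lam * r * Real.exp (-(lam * Real.pi * r ^ 2))))

/-! ### The functions in the bound -/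

/-- Gauss' hypergeometric function `₂F₁(a, b; c; x)` for real `0 < b < c` and `x < 1`, given by
Euler's integral. (Mathlib's `₂F₁` is the sum of the power series, hence a junk value for
`x < -1`, where the analytic continuation is needed here.) -/
def hyp2F1 (a b c x : ℝ) : ℝ :=
  Real.Gamma c / (Real.Gamma b * Real.Gamma (c - b)) *
    ∫ t in (0 : ℝ)..1, t ^ (b - 1) * (1 - t) ^ (c - b - 1) * (1 - x * t) ^ (-a)

/-- `Λ(ρ, T) = ₂F₁(1, (α - 2) / α; 2 - 2 / α; -ρ ^ α T)`. -/
def bigLambda (α ρ T : ℝ) : ℝ :=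
  hyp2F1 1 ((α - 2) / α) (2 - 2 / α) (-(ρ ^ α * T))

/-- `R'`: the distance from a user at distance `ru ≤ R` from `O` to the point of the circle of
radius `R` around `O` that is seen at the angle `θ` from the outward radial direction. -/
def bdryDist (R ru θ : ℝ) : ℝ :=
  √(Real.cos θ ^ 2 * ru ^ 2 - ru ^ 2 + R ^ 2) - Real.cos θ * ru

/-- `Θ`: the angle between the outward radial direction and the points of intersection of the circle
of radius `rb` around the user with the circle of radius `R` around `O`. -/
def interAngle (R ru rb : ℝ) : ℝ :=
  Real.pi - Real.arccos ((rb ^ 2 + ru ^ 2 - R ^ 2) / (2 * rb * ru))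

/-- The integrand `T rb ^ α R' ^ (2 - α) Λ(rb / R', T) / (α - 2)` at the angle `θ`. -/
def angularTerm (α R T ru rb θ : ℝ) : ℝ :=
  T * rb ^ α * bdryDist R ru θ ^ (2 - α) * bigLambda α (rb / bdryDist R ru θ) T / (α - 2)

/-- `P₁(T)`, for type-I users. -/
def P₁ (lam α R σ T ru rb : ℝ) : ℝ :=
  Real.exp (-(T * rb ^ α * σ ^ 2)) *
    Real.exp (-(lam * ∫ θ in (0 : ℝ)..(2 * Real.pi), angularTerm α R T ru rb θ))

/-- `P₂(T)`, for type-II users. -/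
def P₂ (lam α R σ T ru rb : ℝ) : ℝ :=
  Real.exp (-(T * rb ^ α * σ ^ 2)) *
    Real.exp (-(lam * (2 * interAngle R ru rb) * (T * rb ^ 2 * bigLambda α 1 T / (α - 2)))) *
    Real.exp (-(lam * ∫ θ in (interAngle R ru rb)..(2 * Real.pi - interAngle R ru rb),
      angularTerm α R T ru rb θ))

open Classical in
/-- `P₁(T) 𝟏(r_b < R - r_u)`. -/
def typeITerm (lam α R σ T ru rb : ℝ) : ℝ :=
  if rb < R - ru then P₁ lam α R σ T ru rb else 0

open Classical in
/-- `P₂(T) 𝟏(R - r_u < r_b < R + r_u)`. -/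
def typeIITerm (lam α R σ T ru rb : ℝ) : ℝ :=
  if R - ru < rb ∧ rb < R + ru then P₂ lam α R σ T ru rb else 0

end CloudRadio

end

noncomputable section

namespace CloudRadio

/-! ### The function `e⁻ˣ` on `[0, ∞]` -/

/-! Freeze the user at `u` and suppose that its server is at distance `r`. Since `|h|²` is
exponential of mean one, coverage given the noise and the interference `I` has probability `exp (-T
r ^ α (σ ^ 2 + I))`. Averaging over the fading of an interferer at `y` gives the factor `1 / (1 +
c)` with `c = T (r / ‖y - u‖) ^ α`. The Laplace functional of the Poisson process beyond `r` then
gives `exp (-lam ∫ c / (1 + c))`, the integral being over the points outside the cluster at distance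
at least `r` from `u`; this is `condCoverage`.

Conditioning on the exact serving distance is singular. It is replaced by the events of
`nearestInAnnulus`: an empty ball of radius `a` and a single point in the annulus between `a` and
`b`. All factors decrease when the serving distance is rounded up to `b`, so `le_prob_inCoverage`
and `setLIntegral_nearestInAnnulus` bound the coverage from below on each event. Summing over a grid
and letting its mesh tend to zero with Fatou's lemma gives `lintegral_condCoverage_le`.

The exponent is computed in polar coordinates around `u`. In direction `θ` the interferers start at
`max r R'(θ)`, and the substitution `r = l t ^ (-1 / α)` turns the radial integral into Euler's
integral for `₂F₁` (`radialTail_eq`). If `r_b < R - r_u`, the maximum is `R'` everywhere, which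
gives `P₁`. If `R - r_u < r_b < R + r_u`, it is `r_b` on the arc `|θ| ≤ Θ` and `R'` on the rest,
which gives `P₂`. The users with `r_b ≥ R + r_u` contribute a nonnegative amount that is discarded.
-/

/-- `e⁻ˣ` for `x ∈ [0, ∞]`. -/
def negExp (x : ℝ≥0∞) : ℝ≥0∞ := EReal.exp (-(x : EReal))

@[simp] lemma negExp_zero : negExp 0 = 1 := by simp [negExp]

@[simp] lemma negExp_top : negExp ∞ = 0 := by simp [negExp]

lemma negExp_add (x y : ℝ≥0∞) : negExp (x + y) = negExp x * negExp y := by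
  rw [negExp, negExp, negExp, ← EReal.exp_add, EReal.coe_ennreal_add]
  congr 1
  rw [EReal.neg_add] <;> simp [sub_eq_add_neg]

lemma negExp_ofReal {x : ℝ} (hx : 0 ≤ x) : negExp (ENNReal.ofReal x) = ENNReal.ofReal (Real.exp (-x)) := by
  rw [negExp, EReal.coe_ennreal_ofReal, max_eq_left hx, ← EReal.coe_neg, EReal.exp_coe]

lemma negExp_antitone : Antitone negExp := fun x y h => by
  simpa [negExp] using h

lemma negExp_le_one (x : ℝ≥0∞) : negExp x ≤ 1 := by
  simpa using negExp_antitone (zero_le (a := x))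

lemma continuous_negExp : Continuous negExp :=
  ENNReal.continuous_exp.comp (continuous_neg.comp continuous_coe_ennreal_ereal)

lemma measurable_negExp : Measurable negExp := continuous_negExp.measurable

lemma negExp_sum {ι : Type*} (s : Finset ι) (f : ι → ℝ≥0∞) :
    negExp (∑ i ∈ s, f i) = ∏ i ∈ s, negExp (f i) := by
  classical
  induction s using Finset.induction_on with
  | empty => simp
  | insert a s ha ih => rw [Finset.sum_insert ha, Finset.prod_insert ha, negExp_add, ih]

lemma tendsto_negExp_tsum (f : ℕ → ℝ≥0∞) :
    Filter.Tendsto (fun n => ∏ i ∈ Finset.range n, negExp (f i)) Filter.atTop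
      (nhds (negExp (∑' i, f i))) := by
  simp_rw [← negExp_sum]
  exact (continuous_negExp.tendsto _).comp (ENNReal.tendsto_nat_tsum f)

/-! ### Counting the points of a Poisson process -/

section Poisson

lemma coe_pointCount {Ω : Type*} (X : ℕ → Ω → Plane) (A : Set Plane) (ω : Ω) :
    ((pointCount X A ω : ℕ∞) : ℝ≥0∞) = ∑' n, A.indicator (fun _ => 1) (X n ω) := by
  have := ENNReal.tsum_set_one {n : ℕ | X n ω ∈ A}
  rw [pointCount, ← this]
  exact tsum_subtype {n : ℕ | X n ω ∈ A} (fun _ => (1 : ℝ≥0∞))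

variable {Ω : Type*} [MeasurableSpace Ω] {P : Measure Ω} {lam : ℝ} {X : ℕ → Ω → Plane}

lemma measurable_pointCount (hX : ∀ n, Measurable (X n)) {A : Set Plane} (hA : MeasurableSet A) :
    Measurable (pointCount X A) := by
  have h : Measurable fun ω => ((pointCount X A ω : ℕ∞) : ℝ≥0∞) := by
    simp_rw [coe_pointCount]
    exact Measurable.tsum fun n => (measurable_const.indicator hA).comp (hX n)
  refine ENat.measurable_iff.2 fun n => ?_
  have : pointCount X A ⁻¹' {(n : ℕ∞)} =
      (fun ω => ((pointCount X A ω : ℕ∞) : ℝ≥0∞)) ⁻¹' {((n : ℕ∞) : ℝ≥0∞)} := by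
    ext ω
    simp only [mem_preimage, mem_singleton_iff, ENat.toENNReal_inj]
  rw [this]
  exact h (measurableSet_singleton _)

/-- The generating function `E[q ^ N] = exp (-m (1 - q))` of a Poisson variable, at `q = e⁻ᵃ`. The
case `a = 0` is normalisation, and `a = ∞` is the void probability. -/
lemma negExp_poisson_series {m : ℝ} (hm : 0 ≤ m) (a : ℝ≥0∞) :
    ∑' k : ℕ, negExp (k * a) * ENNReal.ofReal (Real.exp (-m) * m ^ k / (k.factorial : ℝ)) =
      negExp (ENNReal.ofReal m * (1 - negExp a)) := by
  have hle := negExp_le_one a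
  set q := (negExp a).toReal with hq
  have hqa : negExp a = ENNReal.ofReal q :=
    (ENNReal.ofReal_toReal (ne_top_of_le_ne_top ENNReal.one_ne_top hle)).symm
  have hq0 : 0 ≤ q := ENNReal.toReal_nonneg
  have hq1 : q ≤ 1 := by
    have := ENNReal.toReal_mono ENNReal.one_ne_top hle
    simpa using this
  have h1 : ∀ k : ℕ, negExp (k * a) = ENNReal.ofReal (q ^ k) := by
    intro k
    induction k with
    | zero => simp
    | succ k ih =>
      rw [Nat.cast_succ, add_mul, one_mul, negExp_add, ih, hqa, ← ENNReal.ofReal_mul (by positivity),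
        pow_succ]
  have hterm : ∀ k : ℕ, negExp (k * a) * ENNReal.ofReal (Real.exp (-m) * m ^ k / (k.factorial : ℝ)) =
      ENNReal.ofReal (Real.exp (-m) * ((q * m) ^ k / (k.factorial : ℝ))) := by
    intro k
    rw [h1, ← ENNReal.ofReal_mul (by positivity)]
    congr 1
    rw [mul_pow]; ring
  simp_rw [hterm]
  have hs : HasSum (fun k : ℕ => Real.exp (-m) * ((q * m) ^ k / (k.factorial : ℝ)))
      (Real.exp (-m) * Real.exp (q * m)) := by
    have := NormedSpace.expSeries_div_hasSum_exp (q * m)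
    rw [← Real.exp_eq_exp_ℝ] at this
    exact this.mul_left _
  rw [← ENNReal.ofReal_tsum_of_nonneg (fun k => by positivity) hs.summable, hs.tsum_eq, hqa,
    ← ENNReal.ofReal_one, ← ENNReal.ofReal_sub _ hq0, ← ENNReal.ofReal_mul hm,
    negExp_ofReal (mul_nonneg hm (by linarith)), ← Real.exp_add]
  congr 2; ring

/-- The Poisson weights of the finite counts already sum to one. -/
lemma IsPoissonProcess.prob_count_ne_top [IsProbabilityMeasure P] (hlam : 0 < lam)
    (hX : IsPoissonProcess P lam X) {A : Set Plane} (hA : MeasurableSet A) (hA' : volume A ≠ ∞) :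
    P {ω | pointCount X A ω = ⊤} = 0 := by
  have hmeas := measurable_pointCount hX.measurable hA
  have h1 : P {ω | pointCount X A ω ≠ ⊤} = 1 := by
    have : {ω | pointCount X A ω ≠ ⊤} = ⋃ k : ℕ, {ω | pointCount X A ω = k} := by
      ext ω
      simp only [mem_ofPred_eq, mem_iUnion]
      exact ⟨fun h => ⟨_, (ENat.natCast_toNat h).symm⟩, fun ⟨k, hk⟩ => by simp [hk]⟩
    rw [this, measure_iUnion]
    · simp_rw [hX.count_law A hA hA']
      have := negExp_poisson_series (m := lam * volume.real A) (by positivity) 0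
      simpa using this
    · intro i j hij
      refine Set.disjoint_left.2 fun ω hi hj => hij ?_
      simp only [mem_ofPred_eq] at hi hj
      exact_mod_cast hi.symm.trans hj
    · exact fun k => hmeas (measurableSet_singleton _)
  have := prob_compl_eq_zero_iff (μ := P) (s := {ω | pointCount X A ω ≠ ⊤})
    (hmeas (measurableSet_singleton ⊤)).compl
  rw [← this.2 h1]
  congr 1; ext; simp

lemma IsPoissonProcess.lintegral_negExp_count [IsProbabilityMeasure P] (hlam : 0 < lam)
    (hX : IsPoissonProcess P lam X) {A : Set Plane} (hA : MeasurableSet A) (hA' : volume A ≠ ∞)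
    (a : ℝ≥0∞) :
    ∫⁻ ω, negExp ((pointCount X A ω : ℕ∞) * a) ∂P =
      negExp (ENNReal.ofReal lam * volume A * (1 - negExp a)) := by
  have hmeas := measurable_pointCount hX.measurable hA
  have h1 : ∫⁻ ω, negExp ((pointCount X A ω : ℕ∞) * a) ∂P =
      ∫⁻ ω, ∑' k : ℕ, {ω | pointCount X A ω = k}.indicator (fun _ => negExp (k * a)) ω ∂P := by
    refine lintegral_congr_ae ?_
    have h0 : ∀ᵐ ω ∂P, pointCount X A ω ≠ ⊤ := by
      rw [ae_iff]; simpa using hX.prob_count_ne_top hlam hA hA'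
    filter_upwards [h0] with ω hω
    obtain ⟨k, hk⟩ := ENat.ne_top_iff_exists.1 hω
    rw [tsum_eq_single k]
    · rw [indicator_of_mem (by simp [← hk]), ← hk]; simp
    · intro j hj
      refine indicator_of_notMem ?_ _
      simp only [mem_ofPred_eq, ← hk]
      exact fun h => hj (by exact_mod_cast h.symm)
  have hs : ∀ k : ℕ, MeasurableSet {ω | pointCount X A ω = k} :=
    fun k => hmeas (measurableSet_singleton (k : ℕ∞))
  rw [h1, lintegral_tsum fun k => (measurable_const.indicator (hs k)).aemeasurable]
  have h2 : ∀ k : ℕ, ∫⁻ ω, {ω | pointCount X A ω = k}.indicator (fun _ => negExp (k * a)) ω ∂P =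
      negExp (k * a) * ENNReal.ofReal (Real.exp (-(lam * volume.real A)) * (lam * volume.real A) ^ k /
        (k.factorial : ℝ)) := by
    intro k
    rw [lintegral_indicator_const (hs k), hX.count_law A hA hA']
  simp_rw [h2]
  rw [negExp_poisson_series (by positivity), ENNReal.ofReal_mul hlam.le, ofReal_measureReal hA']

end Poisson

/-! ### The Laplace functional of a Poisson process -/

section Laplace

/-- The sum is grouped by level sets. The level `0` is left out because its level set may have
infinite area. -/
lemma tsum_simpleFunc_comp {Ω : Type*} (X : ℕ → Ω → Plane) (f : SimpleFunc Plane ℝ≥0∞) (ω : Ω) :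
    ∑' k, f (X k ω) =
      ∑ v : {v // v ∈ f.range.filter (· ≠ 0)}, (pointCount X (f ⁻¹' {v.1}) ω : ℕ∞) * v.1 := by
  have h : ∀ y, f y = ∑ v : {v // v ∈ f.range.filter (· ≠ 0)},
      (f ⁻¹' {v.1}).indicator (fun _ => (1 : ℝ≥0∞)) y * v.1 := by
    intro y
    by_cases hy : f y = 0
    · rw [Finset.sum_eq_zero, hy]
      rintro ⟨v, hv⟩ -
      rw [indicator_of_notMem, zero_mul]
      simp only [mem_preimage, mem_singleton_iff, hy]
      exact fun h => (Finset.mem_filter.1 hv).2 h.symm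
    · have hm : f y ∈ f.range.filter (· ≠ 0) :=
        Finset.mem_filter.2 ⟨f.mem_range_self y, hy⟩
      rw [Finset.sum_eq_single ⟨f y, hm⟩]
      · simp
      · rintro ⟨v, hv⟩ - hne
        rw [indicator_of_notMem, zero_mul]
        simp only [mem_preimage, mem_singleton_iff]
        exact fun h => hne (Subtype.ext h.symm)
      · simp
  calc ∑' k, f (X k ω) = ∑' k, ∑ v : {v // v ∈ f.range.filter (· ≠ 0)},
        (f ⁻¹' {v.1}).indicator (fun _ => (1 : ℝ≥0∞)) (X k ω) * v.1 := by simp_rw [← h]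
    _ = _ := by
      rw [Summable.tsum_finsetSum fun _ _ => ENNReal.summable]
      simp_rw [ENNReal.tsum_mul_right, coe_pointCount]

variable {Ω : Type*} [MeasurableSpace Ω] {P : Measure Ω} {lam : ℝ} {X : ℕ → Ω → Plane}

lemma lintegral_one_sub_negExp_simpleFunc (f : SimpleFunc Plane ℝ≥0∞) :
    ∫⁻ y, (1 - negExp (f y)) =
      ∑ v : {v // v ∈ f.range.filter (· ≠ 0)}, volume (f ⁻¹' {v.1}) * (1 - negExp v.1) := by
  have h1 : ∫⁻ y, (1 - negExp (f y)) = (f.map fun v => 1 - negExp v).lintegral volume := by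
    rw [← SimpleFunc.lintegral_eq_lintegral]; rfl
  rw [h1, SimpleFunc.map_lintegral, Finset.sum_coe_sort
    (f.range.filter (· ≠ 0)) (fun v => volume (f ⁻¹' {v}) * (1 - negExp v)), Finset.sum_filter]
  refine Finset.sum_congr rfl fun v _ => ?_
  split_ifs with h
  · rw [mul_comm]
  · simp only [ne_eq, not_not] at h
    simp [h]

/-- The set `A` and the nonzero level sets of `f` are disjoint, so their counts are independent and
the expectation factorises. -/
lemma IsPoissonProcess.setLIntegral_negExp_tsum_simpleFunc [IsProbabilityMeasure P] (hlam : 0 < lam)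
    (hX : IsPoissonProcess P lam X) {A : Set Plane} (hA : MeasurableSet A)
    (f : SimpleFunc Plane ℝ≥0∞) (hf : volume (Function.support f) ≠ ∞) (hfA : ∀ y ∈ A, f y = 0) :
    ∫⁻ ω in {ω | pointCount X A ω = 1}, negExp (∑' k, f (X k ω)) ∂P =
      P {ω | pointCount X A ω = 1} *
        negExp (ENNReal.ofReal lam * ∫⁻ y, (1 - negExp (f y))) := by
  classical
  set V := {v // v ∈ f.range.filter (· ≠ 0)}
  -- The index `none` stands for `A`, so that one family of counts carries both the event and the
  -- sum.
  let S : Option V → Set Plane := fun o => o.elim A fun v => f ⁻¹' {v.1}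
  have hS : ∀ o, MeasurableSet (S o) := by
    rintro (_ | v)
    · exact hA
    · exact f.measurableSet_preimage _
  have hv0 : ∀ v : V, v.1 ≠ 0 := fun v => (Finset.mem_filter.1 v.2).2
  have hdisj : Pairwise fun i j => Disjoint (S i) (S j) := by
    rintro (_ | v) (_ | w) hvw
    · exact absurd rfl hvw
    · exact Set.disjoint_left.2 fun y hy hy' => hv0 w ((hfA y hy).symm.trans hy').symm
    · exact Set.disjoint_left.2 fun y hy' hy => hv0 v ((hfA y hy).symm.trans hy').symm
    · refine Set.disjoint_left.2 fun y hy hy' => hvw ?_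
      exact congrArg some (Subtype.ext (hy.symm.trans hy'))
  have hfin : ∀ v : V, volume (S (some v)) ≠ ∞ := fun v =>
    ne_top_of_le_ne_top hf (measure_mono fun y hy => by
      have : f y = v.1 := hy
      simpa [this] using hv0 v)
  let e := Fintype.equivFin (Option V)
  have hind : iIndepFun (fun o => pointCount X (S o)) P := by
    have := (hX.count_indep _ (fun i => S (e.symm i)) (fun i => hS _)
      (fun i j hij => hdisj fun h => hij (e.symm.injective h))).precomp e.injective
    simpa [Function.comp_def] using this
  let g : Option V → ℕ∞ → ℝ≥0∞ := fun o n =>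
    o.elim (if n = 1 then 1 else 0) fun v => negExp ((n : ℝ≥0∞) * v.1)
  have hprod := lintegral_prod_eq_prod_lintegral_of_indepFun Finset.univ
    (fun o ω => g o (pointCount X (S o) ω))
    (hind.comp g fun _ => measurable_of_countable _)
    (fun o => (measurable_of_countable (g o)).comp (measurable_pointCount hX.measurable (hS o)))
  have hE : MeasurableSet {ω | pointCount X A ω = 1} :=
    measurable_pointCount hX.measurable hA (measurableSet_singleton 1)
  simp only [Fintype.prod_option] at hprod
  have hL : ∀ ω, {ω | pointCount X A ω = 1}.indicator (fun ω => negExp (∑' k, f (X k ω))) ω =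
      g none (pointCount X (S none) ω) * ∏ v, g (some v) (pointCount X (S (some v)) ω) := by
    intro ω
    by_cases h : pointCount X A ω = 1
    · rw [indicator_of_mem (by exact h), tsum_simpleFunc_comp, negExp_sum]
      change _ = (if pointCount X A ω = 1 then 1 else 0) * _
      rw [if_pos h, one_mul]
      rfl
    · rw [indicator_of_notMem (by exact h)]
      simp [g, S, h]
  rw [← lintegral_indicator hE, lintegral_congr hL, hprod]
  congr 1
  · have : ∀ ω, g none (pointCount X (S none) ω) =
        {ω | pointCount X A ω = 1}.indicator (fun _ => 1) ω := by
      intro ω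
      simp [g, S, indicator_apply]
    rw [lintegral_congr this, lintegral_indicator_const hE, one_mul]
  · rw [lintegral_one_sub_negExp_simpleFunc, Finset.mul_sum, negExp_sum]
    refine Finset.prod_congr rfl fun v _ => ?_
    have := hX.lintegral_negExp_count hlam (hS (some v)) (hfin v) v.1
    rw [← mul_assoc]
    exact this

/-- The Laplace functional of a Poisson process, on the event that a set on which the function
vanishes contains exactly one point. -/
lemma IsPoissonProcess.setLIntegral_negExp_tsum [IsProbabilityMeasure P] (hlam : 0 < lam)
    (hX : IsPoissonProcess P lam X) {A : Set Plane} (hA : MeasurableSet A)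
    {f : Plane → ℝ≥0∞} (hf : Measurable f) (hfA : ∀ y ∈ A, f y = 0) :
    ∫⁻ ω in {ω | pointCount X A ω = 1}, negExp (∑' k, f (X k ω)) ∂P =
      P {ω | pointCount X A ω = 1} *
        negExp (ENNReal.ofReal lam * ∫⁻ y, (1 - negExp (f y))) := by
  -- Restricting to balls gives the approximants supports of finite area, as the counting law
  -- requires.
  let F : ℕ → SimpleFunc Plane ℝ≥0∞ := fun n =>
    (SimpleFunc.eapprox f n).restrict (Metric.ball 0 n)
  have hFapp : ∀ n y, F n y = (Metric.ball 0 (n : ℝ)).indicator (SimpleFunc.eapprox f n) y :=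
    fun n y => by rw [SimpleFunc.restrict_apply _ Metric.isOpen_ball.measurableSet]
  have hFmono : ∀ y, Monotone fun n => F n y := by
    intro y m n hmn
    simp only [hFapp]
    refine (indicator_le_indicator (SimpleFunc.monotone_eapprox f hmn y)).trans ?_
    exact indicator_le_indicator_of_subset (Metric.ball_subset_ball (by exact_mod_cast hmn))
      (fun _ => zero_le) y
  have hFle : ∀ n y, F n y ≤ f y := by
    intro n y
    rw [hFapp]
    refine (indicator_le_self _ _ y).trans ?_
    rw [← SimpleFunc.iSup_eapprox_apply hf y]
    exact le_iSup (fun n => SimpleFunc.eapprox f n y) n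
  have hFtend : ∀ y, Filter.Tendsto (fun n => F n y) Filter.atTop (nhds (f y)) := by
    intro y
    refine (SimpleFunc.tendsto_eapprox hf y).congr' ?_
    obtain ⟨N, hN⟩ := exists_nat_gt ‖y‖
    filter_upwards [Filter.eventually_ge_atTop N] with n hn
    rw [hFapp, indicator_of_mem]
    simp only [Metric.mem_ball, dist_zero_right]
    exact hN.trans_le (by exact_mod_cast hn)
  have hFsup : ∀ y, ⨆ n, F n y = f y := fun y =>
    tendsto_nhds_unique (tendsto_atTop_iSup (hFmono y)) (hFtend y)
  have hsimple := fun n => hX.setLIntegral_negExp_tsum_simpleFunc hlam hA (F n)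
    (by
      refine ne_top_of_le_ne_top (measure_ball_lt_top (x := (0 : Plane)) (r := n)).ne
        (measure_mono fun y hy => ?_)
      by_contra h
      exact hy (by rw [hFapp, indicator_of_notMem h]))
    (fun y hy => le_antisymm ((hFle n y).trans (hfA y hy).le) zero_le)
  have hsum : ∀ ω, Filter.Tendsto (fun n => ∑' k, F n (X k ω)) Filter.atTop
      (nhds (∑' k, f (X k ω))) := by
    intro ω
    simp_rw [← lintegral_count]
    exact lintegral_tendsto_of_tendsto_of_monotone
      (fun n => (measurable_of_countable _).aemeasurable)
      (Filter.Eventually.of_forall fun k => hFmono _)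
      (Filter.Eventually.of_forall fun k => hFtend _)
  have hmeas : ∀ g : Plane → ℝ≥0∞, Measurable g → Measurable fun ω => negExp (∑' k, g (X k ω)) :=
    fun g hg => measurable_negExp.comp (Measurable.tsum fun k => hg.comp (hX.measurable k))
  have hleft : Filter.Tendsto (fun n => ∫⁻ ω in {ω | pointCount X A ω = 1},
      negExp (∑' k, F n (X k ω)) ∂P) Filter.atTop
      (nhds (∫⁻ ω in {ω | pointCount X A ω = 1}, negExp (∑' k, f (X k ω)) ∂P)) := by
    refine tendsto_lintegral_of_dominated_convergence (fun _ => 1)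
      (fun n => hmeas _ (F n).measurable)
      (fun n => Filter.Eventually.of_forall fun ω => negExp_le_one _) (by simp)
      (Filter.Eventually.of_forall fun ω => ?_)
    exact (continuous_negExp.tendsto _).comp (hsum ω)
  have hint : Filter.Tendsto (fun n => ∫⁻ y, (1 - negExp (F n y))) Filter.atTop
      (nhds (∫⁻ y, (1 - negExp (f y)))) := by
    refine lintegral_tendsto_of_tendsto_of_monotone
      (fun n => (measurable_const.sub (measurable_negExp.comp (F n).measurable)).aemeasurable)
      (Filter.Eventually.of_forall fun y m n hmn =>
        tsub_le_tsub_left (negExp_antitone (hFmono y hmn)) _)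
      (Filter.Eventually.of_forall fun y => ?_)
    exact ((ENNReal.continuous_sub_left ENNReal.one_ne_top).tendsto _).comp
      ((continuous_negExp.tendsto _).comp (hFtend y))
  refine tendsto_nhds_unique hleft ?_
  simp_rw [hsimple]
  refine ENNReal.Tendsto.const_mul ?_ (Or.inr (measure_ne_top P _))
  exact (continuous_negExp.tendsto _).comp
    (ENNReal.Tendsto.const_mul hint (Or.inr ENNReal.ofReal_ne_top))

end Laplace

/-! ### Rayleigh fading -/

/-- Used both for the fading amplitude and, with `c = lam * π`, for the distance to the nearest
point. -/
lemma setLIntegral_Ioi_rayleigh {c s : ℝ} (hc : 0 < c) (hs : 0 ≤ s) :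
    ∫⁻ r in Ioi s, ENNReal.ofReal (2 * c * r * Real.exp (-(c * r ^ 2))) =
      ENNReal.ofReal (Real.exp (-(c * s ^ 2))) := by
  have hderiv : ∀ x ∈ Ici s, HasDerivAt (fun r => -Real.exp (-(c * r ^ 2)))
      (2 * c * x * Real.exp (-(c * x ^ 2))) x := by
    intro x _
    have h1 : HasDerivAt (fun r : ℝ => -(c * r ^ 2)) (-(c * (2 * x))) x := by
      have := ((hasDerivAt_pow 2 x).const_mul c).fun_neg
      simpa using this
    convert! h1.exp.fun_neg using 1
    ring
  have hpos : ∀ x ∈ Ioi s, 0 ≤ 2 * c * x * Real.exp (-(c * x ^ 2)) := by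
    intro x hx
    have : 0 ≤ x := hs.trans (le_of_lt hx)
    positivity
  have hlim : Filter.Tendsto (fun r => -Real.exp (-(c * r ^ 2))) Filter.atTop (nhds 0) := by
    rw [← neg_zero]
    refine (Real.tendsto_exp_atBot.comp ?_).neg
    refine Filter.tendsto_neg_atTop_atBot.comp ?_
    exact Filter.Tendsto.const_mul_atTop hc (Filter.tendsto_pow_atTop two_ne_zero)
  rw [← ofReal_integral_eq_lintegral_ofReal (integrableOn_Ioi_deriv_of_nonneg' hderiv hpos hlim)
    ((ae_restrict_iff' measurableSet_Ioi).2 (Filter.Eventually.of_forall hpos)),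
    integral_Ioi_of_hasDerivAt_of_nonneg' hderiv hpos hlim]
  simp

instance : IsProbabilityMeasure complexGaussian := by
  refine Measure.isProbabilityMeasure_map (Measurable.aemeasurable ?_)
  exact Complex.measurableEquivRealProd.symm.measurable

lemma gaussianPDF_half (x : ℝ) :
    gaussianPDF 0 (1 / 2) x = ENNReal.ofReal ((√Real.pi)⁻¹ * Real.exp (-x ^ 2)) := by
  rw [gaussianPDF, gaussianPDFReal]
  congr 2
  · congr 2
    simp only [NNReal.coe_div, NNReal.coe_one, NNReal.coe_ofNat]
    ring
  · congr 1
    simp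

lemma lintegral_complexGaussian_norm {φ : ℝ → ℝ≥0∞} (hφ : Measurable φ) :
    ∫⁻ z, φ ‖z‖ ∂complexGaussian =
      ∫⁻ r in Ioi 0, ENNReal.ofReal (2 * r * Real.exp (-r ^ 2)) * φ r := by
  have hmeas : Measurable (fun p : ℝ × ℝ => (⟨p.1, p.2⟩ : ℂ)) :=
    Complex.measurableEquivRealProd.symm.measurable
  have hv : (1 / 2 : ℝ≥0) ≠ 0 := by norm_num
  rw [complexGaussian, lintegral_map (f := fun z : ℂ => φ ‖z‖) (hφ.comp measurable_norm) hmeas,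
    gaussianReal_of_var_ne_zero _ hv, prod_withDensity (measurable_gaussianPDF _ _)
      (measurable_gaussianPDF _ _), lintegral_withDensity_eq_lintegral_mul _
      (f := fun z : ℝ × ℝ => gaussianPDF 0 (1 / 2) z.1 * gaussianPDF 0 (1 / 2) z.2)
      (((measurable_gaussianPDF _ _).comp measurable_fst).mul
        ((measurable_gaussianPDF _ _).comp measurable_snd))
      (g := fun p : ℝ × ℝ => φ ‖(⟨p.1, p.2⟩ : ℂ)‖) ((hφ.comp measurable_norm).comp hmeas), ← Measure.volume_eq_prod,
    ← lintegral_comp_polarCoord_symm]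
  have hpt : ∀ p ∈ polarCoord.target, ENNReal.ofReal p.1 •
      (((fun z : ℝ × ℝ => gaussianPDF 0 (1 / 2) z.1 * gaussianPDF 0 (1 / 2) z.2) *
        fun p : ℝ × ℝ => φ ‖(⟨p.1, p.2⟩ : ℂ)‖) (polarCoord.symm p)) =
      ENNReal.ofReal (p.1 * Real.pi⁻¹ * Real.exp (-p.1 ^ 2)) * φ p.1 := by
    rintro ⟨r, θ⟩ hp
    have hr : 0 < r := hp.1
    simp only [polarCoord_symm_apply, Pi.mul_apply, gaussianPDF_half, smul_eq_mul]
    have hn : ‖(⟨r * Real.cos θ, r * Real.sin θ⟩ : ℂ)‖ = r := by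
      rw [Complex.norm_def, Complex.normSq_mk, Real.sqrt_eq_iff_mul_self_eq
        (add_nonneg (mul_self_nonneg _) (mul_self_nonneg _)) hr.le]
      nlinarith [Real.sin_sq_add_cos_sq θ]
    rw [hn, ← ENNReal.ofReal_mul (by positivity), ← mul_assoc, ← ENNReal.ofReal_mul hr.le]
    congr 2
    have h1 : (√Real.pi)⁻¹ * (√Real.pi)⁻¹ = Real.pi⁻¹ := by
      rw [← mul_inv, Real.mul_self_sqrt Real.pi_pos.le]
    have h2 : Real.exp (-(r * Real.cos θ) ^ 2) * Real.exp (-(r * Real.sin θ) ^ 2) =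
        Real.exp (-r ^ 2) := by
      rw [← Real.exp_add]
      congr 1
      linear_combination (-r ^ 2) * Real.sin_sq_add_cos_sq θ
    rw [← h1, ← h2]
    ring
  rw [setLIntegral_congr_fun polarCoord.open_target.measurableSet hpt]
  have htar : polarCoord.target = Ioi (0 : ℝ) ×ˢ Ioo (-Real.pi) Real.pi := rfl
  rw [htar, Measure.volume_eq_prod, ← Measure.prod_restrict, lintegral_prod _ (by fun_prop)]
  simp only [lintegral_const, Measure.restrict_apply MeasurableSet.univ, univ_inter,
    Real.volume_Ioo]
  refine setLIntegral_congr_fun measurableSet_Ioi fun r hr => ?_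
  have hr' : 0 < r := hr
  rw [mul_right_comm, ← ENNReal.ofReal_mul (by positivity)]
  congr 2
  field_simp
  ring

/-- The power `|h|²` is exponential of mean one. The value `t = ∞` is included because the
interference is not known to be finite. -/
lemma complexGaussian_tail (t : ℝ≥0∞) :
    complexGaussian {z | t < ENNReal.ofReal (‖z‖ ^ 2)} = negExp t := by
  induction t with
  | top => simp
  | coe s =>
    have hm : MeasurableSet {r : ℝ | (s : ℝ≥0∞) < ENNReal.ofReal (r ^ 2)} :=
      measurableSet_lt measurable_const (by fun_prop)
    have hm' : MeasurableSet {z : ℂ | (s : ℝ≥0∞) < ENNReal.ofReal (‖z‖ ^ 2)} :=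
      measurableSet_lt measurable_const (by fun_prop)
    have h1 := lintegral_complexGaussian_norm
      (φ := {r : ℝ | (s : ℝ≥0∞) < ENNReal.ofReal (r ^ 2)}.indicator fun _ => 1)
      (measurable_const.indicator hm)
    have h2 : ∀ z : ℂ, {r : ℝ | (s : ℝ≥0∞) < ENNReal.ofReal (r ^ 2)}.indicator
        (fun _ => (1 : ℝ≥0∞)) ‖z‖ =
        {z : ℂ | (s : ℝ≥0∞) < ENNReal.ofReal (‖z‖ ^ 2)}.indicator (fun _ => 1) z := fun z => rfl
    rw [lintegral_congr h2, lintegral_indicator_const hm', one_mul] at h1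
    rw [h1]
    have h3 := setLIntegral_Ioi_rayleigh one_pos (Real.sqrt_nonneg (s : ℝ))
    have h4 : ∀ r : ℝ, ENNReal.ofReal (2 * r * Real.exp (-r ^ 2)) *
        {r : ℝ | (s : ℝ≥0∞) < ENNReal.ofReal (r ^ 2)}.indicator (fun _ => 1) r =
        {r : ℝ | (s : ℝ≥0∞) < ENNReal.ofReal (r ^ 2)}.indicator
          (fun r => ENNReal.ofReal (2 * r * Real.exp (-r ^ 2))) r := by
      intro r
      by_cases hr : r ∈ {r : ℝ | (s : ℝ≥0∞) < ENNReal.ofReal (r ^ 2)}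
      · rw [indicator_of_mem hr, indicator_of_mem hr, mul_one]
      · rw [indicator_of_notMem hr, indicator_of_notMem hr, mul_zero]
    rw [lintegral_congr h4, lintegral_indicator hm, Measure.restrict_restrict hm]
    have h5 : {r : ℝ | (s : ℝ≥0∞) < ENNReal.ofReal (r ^ 2)} ∩ Ioi 0 = Ioi (√(s : ℝ)) := by
      ext r
      simp only [mem_inter_iff, mem_ofPred_eq, mem_Ioi]
      rw [← ENNReal.ofReal_coe_nnreal]
      constructor
      · rintro ⟨h, hr⟩
        exact (Real.sqrt_lt' hr).2 ((ENNReal.ofReal_lt_ofReal_iff (by positivity)).1 h)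
      · intro h
        have hr : 0 < r := (Real.sqrt_nonneg _).trans_lt h
        exact ⟨(ENNReal.ofReal_lt_ofReal_iff (by positivity)).2 ((Real.sqrt_lt' hr).1 h), hr⟩
    rw [h5]
    rw [one_mul, Real.sq_sqrt (NNReal.coe_nonneg s)] at h3
    simp only [one_mul, mul_one] at h3
    rw [h3, ← ENNReal.ofReal_coe_nnreal, negExp_ofReal (NNReal.coe_nonneg s)]

/-- The Laplace transform `1 / (1 + c)` is written as `exp (-log (1 + c))`, so that a product over
the interferers becomes the exponential of a sum over the points. -/
lemma lintegral_complexGaussian_negExp {c : ℝ} (hc : 0 ≤ c) :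
    ∫⁻ z, negExp (ENNReal.ofReal c * ENNReal.ofReal (‖z‖ ^ 2)) ∂complexGaussian =
      negExp (ENNReal.ofReal (Real.log (1 + c))) := by
  rw [lintegral_complexGaussian_norm
    (φ := fun r => negExp (ENNReal.ofReal c * ENNReal.ofReal (r ^ 2)))
    (measurable_negExp.comp (by fun_prop))]
  have h1 : ∀ r ∈ Ioi (0 : ℝ), ENNReal.ofReal (2 * r * Real.exp (-r ^ 2)) *
      negExp (ENNReal.ofReal c * ENNReal.ofReal (r ^ 2)) =
      ENNReal.ofReal (1 + c)⁻¹ *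
        ENNReal.ofReal (2 * (1 + c) * r * Real.exp (-((1 + c) * r ^ 2))) := by
    intro r hr
    have hr' : 0 < r := hr
    rw [← ENNReal.ofReal_mul hc, negExp_ofReal (by positivity), ← ENNReal.ofReal_mul (by positivity),
      ← ENNReal.ofReal_mul (by positivity)]
    congr 1
    rw [mul_assoc, ← Real.exp_add]
    have : (1 + c) ≠ 0 := by positivity
    field_simp
    ring_nf
  rw [setLIntegral_congr_fun measurableSet_Ioi h1, lintegral_const_mul _ (by fun_prop),
    setLIntegral_Ioi_rayleigh (by positivity) le_rfl,
    negExp_ofReal (Real.log_nonneg (by linarith)), Real.exp_neg (Real.log _),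
    Real.exp_log (by positivity)]
  simp

/-! ### Averaging over the fading, with the network fixed. -/

section Fading

/-- Only the coefficients of nonzero weight need to be measurable, so the lemma also applies to the
σ-algebra generated by the interferers alone. -/
lemma measurable_const_add_tsum_fading {Ω : Type*} [MeasurableSpace Ω] {h : ℕ → Ω → ℂ} {c : ℕ → ℝ}
    (hh : ∀ k, c k ≠ 0 → Measurable (h k)) (w : ℝ≥0∞) :
    Measurable fun ω => w + ∑' k, ENNReal.ofReal (c k) * ENNReal.ofReal (‖h k ω‖ ^ 2) := by
  refine Measurable.const_add (Measurable.tsum fun k => ?_) w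
  by_cases hk : c k = 0
  · simp only [hk, ENNReal.ofReal_zero, zero_mul]
    exact measurable_const
  · exact (((hh k hk).norm.pow_const 2).ennreal_ofReal).const_mul _

variable {Ω : Type*} [MeasurableSpace Ω] {P : Measure Ω} {h : ℕ → Ω → ℂ}

lemma lintegral_negExp_tsum_fading [IsProbabilityMeasure P] (hh : ∀ n, Measurable (h n))
    (hh_law : ∀ n, P.map (h n) = complexGaussian) (hh_indep : iIndepFun h P)
    {c : ℕ → ℝ} (hc : ∀ k, 0 ≤ c k) :
    ∫⁻ ω, negExp (∑' k, ENNReal.ofReal (c k) * ENNReal.ofReal (‖h k ω‖ ^ 2)) ∂P =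
      negExp (∑' k, ENNReal.ofReal (Real.log (1 + c k))) := by
  have hg : ∀ k, Measurable fun z : ℂ =>
      negExp (ENNReal.ofReal (c k) * ENNReal.ofReal (‖z‖ ^ 2)) :=
    fun k => measurable_negExp.comp (by fun_prop)
  have hfin : ∀ n, ∫⁻ ω, ∏ k ∈ Finset.range n,
      negExp (ENNReal.ofReal (c k) * ENNReal.ofReal (‖h k ω‖ ^ 2)) ∂P =
      ∏ k ∈ Finset.range n, negExp (ENNReal.ofReal (Real.log (1 + c k))) := by
    intro n
    refine (lintegral_prod_eq_prod_lintegral_of_indepFun (Finset.range n) _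
      (hh_indep.comp _ hg) fun k => (hg k).comp (hh k)).trans ?_
    refine Finset.prod_congr rfl fun k _ => ?_
    rw [← lintegral_complexGaussian_negExp (hc k), ← hh_law k, lintegral_map (hg k) (hh k)]
    rfl
  have h1 : Filter.Tendsto (fun n => ∫⁻ ω, ∏ k ∈ Finset.range n,
      negExp (ENNReal.ofReal (c k) * ENNReal.ofReal (‖h k ω‖ ^ 2)) ∂P) Filter.atTop
      (nhds (∫⁻ ω, negExp (∑' k, ENNReal.ofReal (c k) * ENNReal.ofReal (‖h k ω‖ ^ 2)) ∂P)) := by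
    refine tendsto_lintegral_of_dominated_convergence (fun _ => 1)
      (fun n => Finset.measurable_prod _ fun k _ => (hg k).comp (hh k))
      (fun n => Filter.Eventually.of_forall fun ω => ?_) (by simp)
      (Filter.Eventually.of_forall fun ω => tendsto_negExp_tsum _)
    exact Finset.prod_le_one' fun k _ => negExp_le_one _
  simp_rw [hfin] at h1
  exact tendsto_nhds_unique h1 (tendsto_negExp_tsum _)

/-- The probability that a signal of Rayleigh-distributed amplitude exceeds noise plus a weighted
sum of the powers of independent interferers. -/
lemma prob_fading_gt [IsProbabilityMeasure P] (hh : ∀ n, Measurable (h n))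
    (hh_law : ∀ n, P.map (h n) = complexGaussian) (hh_indep : iIndepFun h P)
    {c : ℕ → ℝ} (hc : ∀ k, 0 ≤ c k) (n : ℕ) (hcn : c n = 0) (w : ℝ≥0∞) :
    P {ω | w + ∑' k, ENNReal.ofReal (c k) * ENNReal.ofReal (‖h k ω‖ ^ 2) <
        ENNReal.ofReal (‖h n ω‖ ^ 2)} =
      negExp (w + ∑' k, ENNReal.ofReal (Real.log (1 + c k))) := by
  set W : Ω → ℝ≥0∞ := fun ω => w + ∑' k, ENNReal.ofReal (c k) * ENNReal.ofReal (‖h k ω‖ ^ 2)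
    with hW
  have hWm : Measurable W := measurable_const_add_tsum_fading (fun k _ => hh k) w
  -- As `c n = 0`, the interference does not involve `h n`; its independence from the signal
  -- follows.
  have hWm' : Measurable[⨆ k ∈ ({n}ᶜ : Set ℕ), MeasurableSpace.comap (h k) inferInstance] W := by
    refine @measurable_const_add_tsum_fading _ (_) _ _ (fun k hk => ?_) w
    have hkn : k ∈ ({n}ᶜ : Set ℕ) := fun h => hk ((congrArg c h).trans hcn)
    refine Measurable.mono (comap_measurable (h k)) ?_ le_rfl
    exact le_iSup₂ (f := fun k (_ : k ∈ ({n}ᶜ : Set ℕ)) =>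
      MeasurableSpace.comap (h k) inferInstance) k hkn
  have hind : IndepFun (h n) W P := by
    have := indep_iSup_of_disjoint (fun i => (hh i).comap_le) hh_indep
      (S := {n}) (T := {n}ᶜ) disjoint_compl_right
    refine indep_of_indep_of_le_left (indep_of_indep_of_le_right this hWm'.comap_le) ?_
    exact le_iSup₂ (f := fun k (_ : k ∈ ({n} : Set ℕ)) =>
        MeasurableSpace.comap (h k) inferInstance) n rfl
  have hjoint := (indepFun_iff_map_prod_eq_prod_map_map (hh n).aemeasurable hWm.aemeasurable).1 hind
  have hset : MeasurableSet {p : ℂ × ℝ≥0∞ | p.2 < ENNReal.ofReal (‖p.1‖ ^ 2)} :=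
    measurableSet_lt measurable_snd (by fun_prop)
  have : IsProbabilityMeasure (P.map W) := Measure.isProbabilityMeasure_map hWm.aemeasurable
  calc P {ω | W ω < ENNReal.ofReal (‖h n ω‖ ^ 2)}
      = (P.map fun ω => (h n ω, W ω)) {p : ℂ × ℝ≥0∞ | p.2 < ENNReal.ofReal (‖p.1‖ ^ 2)} := by
        rw [Measure.map_apply ((hh n).prodMk hWm) hset]; rfl
    _ = ∫⁻ t, complexGaussian {z | t < ENNReal.ofReal (‖z‖ ^ 2)} ∂(P.map W) := by
        rw [hjoint, hh_law, Measure.prod_apply_symm hset]; rfl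
    _ = ∫⁻ ω, negExp w *
          negExp (∑' k, ENNReal.ofReal (c k) * ENNReal.ofReal (‖h k ω‖ ^ 2)) ∂P := by
        simp_rw [complexGaussian_tail]
        rw [lintegral_map measurable_negExp hWm]
        simp_rw [hW, negExp_add]
    _ = _ := by
        have hm : Measurable fun ω =>
            negExp (∑' k, ENNReal.ofReal (c k) * ENNReal.ofReal (‖h k ω‖ ^ 2)) :=
          measurable_negExp.comp (by
            simpa using measurable_const_add_tsum_fading (c := c) (fun k _ => hh k) 0)
        rw [lintegral_const_mul _ hm, lintegral_negExp_tsum_fading hh hh_law hh_indep hc, negExp_add]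

end Fading

/-! ### Coverage of a user at a fixed location -/

/-- The ratio `T (a / ‖y - u‖) ^ α` between the weighted power of an interferer at `y` and that of a
server at distance `a` from `u`. -/
def interfRatio (α T : ℝ) (u : Plane) (a : ℝ) (y : Plane) : ℝ := T * a ^ α * ‖y - u‖ ^ (-α)

/-- The locations outside the cluster at distance at least `a` from `u`. -/
def interfRegion (R : ℝ) (u : Plane) (a : ℝ) : Set Plane := {y | y ∉ cluster R ∧ a ≤ ‖y - u‖}

/-- The exponent contributed by an interferer at `y` after averaging over the fading. -/
def interfExponent (α R T : ℝ) (u : Plane) (a : ℝ) : Plane → ℝ≥0∞ :=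
  (interfRegion R u a).indicator fun y => ENNReal.ofReal (Real.log (1 + interfRatio α T u a y))

/-- The integral over the interfering region in the exponent of the coverage probability of a user
at `u` served at distance `a`. -/
def interfMean (α R T : ℝ) (u : Plane) (a : ℝ) : ℝ≥0∞ :=
  ∫⁻ y, (interfRegion R u a).indicator
    (fun y => ENNReal.ofReal (interfRatio α T u a y / (1 + interfRatio α T u a y))) y

lemma interfRatio_nonneg {α T a : ℝ} (hT : 0 ≤ T) (ha : 0 ≤ a) (u y : Plane) :
    0 ≤ interfRatio α T u a y := by
  unfold interfRatio; positivity

lemma interfRatio_mono {α T a b : ℝ} (hα : 0 ≤ α) (hT : 0 ≤ T) (ha : 0 ≤ a) (hab : a ≤ b)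
    (u y : Plane) : interfRatio α T u a y ≤ interfRatio α T u b y := by
  unfold interfRatio
  gcongr

lemma measurableSet_cluster (R : ℝ) : MeasurableSet (cluster R) :=
  Metric.isClosed_closedBall.measurableSet

lemma measurableSet_interfRegion (R : ℝ) (u : Plane) (a : ℝ) :
    MeasurableSet (interfRegion R u a) :=
  (measurableSet_cluster R).compl.inter (measurableSet_le measurable_const
    (measurable_id.sub_const u).norm)

lemma measurable_interfRatio (α T : ℝ) (u : Plane) (a : ℝ) :
    Measurable (interfRatio α T u a) := by
  unfold interfRatio; fun_prop

lemma measurable_interfExponent (α R T : ℝ) (u : Plane) (a : ℝ) :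
    Measurable (interfExponent α R T u a) :=
  ((Real.measurable_log.comp (measurable_const.add (measurable_interfRatio α T u a))).ennreal_ofReal
    ).indicator (measurableSet_interfRegion R u a)

lemma measurable_interfMean {β : Type*} [MeasurableSpace β] (α R T : ℝ) {u : β → Plane} {a : β → ℝ}
    (hu : Measurable u) (ha : Measurable a) : Measurable fun b => interfMean α R T (u b) (a b) := by
  unfold interfMean
  have h1 : MeasurableSet {q : β × Plane | q.2 ∈ interfRegion R (u q.1) (a q.1)} :=
    ((measurableSet_cluster R).preimage measurable_snd).compl.inter
      (measurableSet_le (ha.comp measurable_fst)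
        (measurable_snd.sub (hu.comp measurable_fst)).norm)
  have h2 : Measurable fun q : β × Plane => ENNReal.ofReal
      (interfRatio α T (u q.1) (a q.1) q.2 / (1 + interfRatio α T (u q.1) (a q.1) q.2)) := by
    unfold interfRatio; fun_prop
  exact (h2.indicator h1).lintegral_prod_right'

/-- Going from `r` to `a` multiplies the ratio by `(a / r) ^ α`, enlarges the denominator and
shrinks the region. This replaces continuity of `interfMean` in the serving distance when the mesh
is refined. -/
lemma interfMean_le {α T : ℝ} (hα : 0 < α) (hT : 0 ≤ T) (R : ℝ) (u : Plane) {r a : ℝ} (hr : 0 < r)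
    (hra : r ≤ a) :
    interfMean α R T u a ≤ ENNReal.ofReal ((a / r) ^ α) * interfMean α R T u r := by
  have ha : 0 ≤ a := hr.le.trans hra
  unfold interfMean
  rw [← lintegral_const_mul' _ _ ENNReal.ofReal_ne_top]
  refine lintegral_mono fun y => ?_
  by_cases hy : y ∈ interfRegion R u a
  · have hy' : y ∈ interfRegion R u r := ⟨hy.1, hra.trans hy.2⟩
    rw [indicator_of_mem hy, indicator_of_mem hy', ← ENNReal.ofReal_mul (by positivity)]
    refine ENNReal.ofReal_le_ofReal ?_
    have h1 : interfRatio α T u a y = (a / r) ^ α * interfRatio α T u r y := by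
      unfold interfRatio
      rw [Real.div_rpow ha hr.le]
      have : r ^ α ≠ 0 := (Real.rpow_pos_of_pos hr _).ne'
      field_simp
    have h2 := interfRatio_nonneg (α := α) hT hr.le u y
    have h3 := interfRatio_mono hα.le hT hr.le hra u y
    rw [← mul_div_assoc, ← h1]
    exact div_le_div_of_nonneg_left (h2.trans h3) (by linarith) (by linarith)
  · rw [indicator_of_notMem hy]; exact zero_le

section FixedUser

variable {Ω : Type*} [MeasurableSpace Ω] {P : Measure Ω} {h : ℕ → Ω → ℂ}

/-- Noise and interference exponents increase with the serving distance, so rounding it up to `a`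
can only lower the bound. All other points are beyond `a`, hence each interferer lies in the region
of `interfExponent`. -/
lemma le_prob_inCoverage [IsProbabilityMeasure P] (hh : ∀ n, Measurable (h n))
    (hh_law : ∀ n, P.map (h n) = complexGaussian) (hh_indep : iIndepFun h P)
    {α R σ T : ℝ} (hα : 0 < α) (hT : 0 < T) {x : ℕ → Plane} {u : Plane} {n : ℕ} {a : ℝ}
    (hn : 0 < ‖x n - u‖) (hna : ‖x n - u‖ < a) (hk : ∀ k, k ≠ n → a ≤ ‖x k - u‖) :
    negExp (ENNReal.ofReal (T * a ^ α * σ ^ 2) + ∑' k, interfExponent α R T u a (x k)) ≤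
      P {ω | InCoverage α R σ T x (fun k => h k ω) u} := by
  classical
  set r := ‖x n - u‖ with hr
  set c : ℕ → ℝ := fun k => if k ≠ n ∧ x k ∉ cluster R then interfRatio α T u r (x k) else 0 with hc
  have hc0 : ∀ k, 0 ≤ c k := by
    intro k
    simp only [hc]
    split_ifs
    exacts [interfRatio_nonneg hT.le hn.le _ _, le_rfl]
  have hprob := prob_fading_gt hh hh_law hh_indep hc0 n (by simp [hc])
    (ENNReal.ofReal (T * r ^ α * σ ^ 2))
  refine (negExp_antitone ?_).trans (hprob.symm.le.trans (measure_mono fun ω hω => ?_))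
  · refine add_le_add (ENNReal.ofReal_le_ofReal (by gcongr)) (ENNReal.tsum_le_tsum fun k => ?_)
    simp only [hc]
    split_ifs with hkn
    · have hmem : x k ∈ interfRegion R u a := ⟨hkn.2, hk k hkn.1⟩
      rw [interfExponent, indicator_of_mem hmem]
      refine ENNReal.ofReal_le_ofReal (Real.log_le_log ?_ ?_)
      · linarith [interfRatio_nonneg (α := α) hT.le hn.le u (x k)]
      · linarith [interfRatio_mono hα.le hT.le hn.le hna.le u (x k)]
    · simp
  · refine ⟨n, fun k hkn => hna.trans_le (hk k hkn), ?_⟩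
    have hra : 0 < r ^ α := Real.rpow_pos_of_pos hn _
    -- The factor `r ^ α` is pulled out, to be cancelled below by the path loss `r ^ (-α)` of the
    -- server.
    have hsum : ENNReal.ofReal (T * r ^ α * σ ^ 2) +
        ∑' k, ENNReal.ofReal (c k) * ENNReal.ofReal (‖h k ω‖ ^ 2) =
        ENNReal.ofReal (r ^ α) * (ENNReal.ofReal T *
          (ENNReal.ofReal (σ ^ 2) + interference α R x (fun k => h k ω) u n)) := by
      rw [← mul_assoc, ← ENNReal.ofReal_mul hra.le, mul_add, ← ENNReal.ofReal_mul (by positivity),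
        interference, ← ENNReal.tsum_mul_left, mul_comm T]
      congr 2
      ext k
      simp only [hc]
      split_ifs
      · rw [rxPower, ← ENNReal.ofReal_mul (interfRatio_nonneg hT.le hn.le _ _),
          ← ENNReal.ofReal_mul (by positivity), interfRatio]
        congr 1; ring
      · simp
    rw [mem_ofPred_eq, hsum] at hω
    rw [sinr]
    have hx : rxPower α x (fun k => h k ω) u n =
        ENNReal.ofReal (r ^ (-α)) * ENNReal.ofReal (‖h n ω‖ ^ 2) := by
      rw [rxPower, ← ENNReal.ofReal_mul (by positivity), mul_comm]
    have hlt := ENNReal.mul_lt_mul_right (a := ENNReal.ofReal (r ^ (-α)))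
      (ENNReal.ofReal_pos.2 (Real.rpow_pos_of_pos hn _)).ne' ENNReal.ofReal_ne_top hω
    rw [← hx, ← mul_assoc, ← ENNReal.ofReal_mul (by positivity), ← Real.rpow_add hn, neg_add_cancel,
      Real.rpow_zero, ENNReal.ofReal_one, one_mul] at hlt
    have hne : rxPower α x (fun k => h k ω) u n ≠ ∞ := ENNReal.ofReal_ne_top
    refine (ENNReal.lt_div_iff_mul_lt (Or.inr ENNReal.ofReal_ne_top) (Or.inr ?_)).2 hlt
    exact (ENNReal.ofReal_pos.2 hT).ne'

end FixedUser

lemma one_sub_negExp_log {c : ℝ} (hc : 0 ≤ c) :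
    1 - negExp (ENNReal.ofReal (Real.log (1 + c))) = ENNReal.ofReal (c / (1 + c)) := by
  rw [negExp_ofReal (Real.log_nonneg (by linarith)), Real.exp_neg, Real.exp_log (by linarith),
    ← ENNReal.ofReal_one, ← ENNReal.ofReal_sub _ (by positivity)]
  congr 1
  have : 1 + c ≠ 0 := by positivity
  field_simp
  ring

/-! ### The nearest point in an annulus. -/

section PoissonAnnulus

variable {Ω : Type*} [MeasurableSpace Ω] {P : Measure Ω} {X : ℕ → Ω → Plane}

/-- No point within distance `a` of `u`, and exactly one within distance `b`. -/
def nearestInAnnulus {Ω : Type*} (X : ℕ → Ω → Plane) (u : Plane) (a b : ℝ) : Set Ω :=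
  {ω | pointCount X (Metric.ball u a) ω = 0 ∧
    pointCount X (Metric.ball u b \ Metric.ball u a) ω = 1}

lemma measurableSet_nearestInAnnulus (hX : ∀ n, Measurable (X n)) (u : Plane) (a b : ℝ) :
    MeasurableSet (nearestInAnnulus X u a b) :=
  (measurable_pointCount hX Metric.isOpen_ball.measurableSet (measurableSet_singleton 0)).inter
    (measurable_pointCount hX (Metric.isOpen_ball.measurableSet.diff
      Metric.isOpen_ball.measurableSet) (measurableSet_singleton 1))

lemma exists_unique_nearest {Ω : Type*} {X : ℕ → Ω → Plane} {u : Plane} {a b : ℝ} {ω : Ω}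
    (hω : ω ∈ nearestInAnnulus X u a b) :
    ∃ n, a ≤ ‖X n ω - u‖ ∧ ‖X n ω - u‖ < b ∧ ∀ k, k ≠ n → b ≤ ‖X k ω - u‖ := by
  obtain ⟨h0, h1⟩ := hω
  rw [pointCount, encard_eq_zero] at h0
  rw [pointCount, encard_eq_one] at h1
  obtain ⟨n, hn⟩ := h1
  have h0' : ∀ k, a ≤ ‖X k ω - u‖ := by
    intro k
    by_contra hlt
    have : k ∈ {n | X n ω ∈ Metric.ball u a} := mem_ball_iff_norm.2 (not_le.1 hlt)
    rw [h0] at this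
    exact this
  have hmem : n ∈ {n | X n ω ∈ Metric.ball u b \ Metric.ball u a} := by rw [hn]; rfl
  refine ⟨n, h0' n, mem_ball_iff_norm.1 hmem.1, fun k hk => ?_⟩
  by_contra hlt
  have : k ∈ {n | X n ω ∈ Metric.ball u b \ Metric.ball u a} :=
    ⟨mem_ball_iff_norm.2 (not_le.1 hlt), fun h => absurd (h0' k) (not_le.2 (mem_ball_iff_norm.1 h))⟩
  rw [hn] at this
  exact hk this

lemma volume_ball_plane (u : Plane) {a : ℝ} (ha : 0 ≤ a) :
    volume (Metric.ball u a) = ENNReal.ofReal (Real.pi * a ^ 2) := by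
  rw [EuclideanSpace.volume_ball_fin_two, ← ENNReal.ofReal_pow ha, mul_comm Real.pi,
    ENNReal.ofReal_mul (by positivity)]

lemma volume_real_annulus (u : Plane) {a b : ℝ} (ha : 0 ≤ a) (hab : a ≤ b) :
    volume.real (Metric.ball u b \ Metric.ball u a) = Real.pi * (b ^ 2 - a ^ 2) := by
  rw [measureReal_sdiff (Metric.ball_subset_ball hab) Metric.isOpen_ball.measurableSet, measureReal_def,
    measureReal_def, volume_ball_plane u ha, volume_ball_plane u (ha.trans hab),
    ENNReal.toReal_ofReal (by positivity), ENNReal.toReal_ofReal (by positivity)]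
  ring

/-- The Laplace functional is applied to a function that vanishes on the annulus and is infinite on
the inner ball, where the infinite weight enforces emptiness. -/
lemma setLIntegral_nearestInAnnulus [IsProbabilityMeasure P] {lam : ℝ} (hlam : 0 < lam)
    (hX : IsPoissonProcess P lam X) {α R T : ℝ} (hT : 0 ≤ T) (u : Plane) {a b : ℝ} (ha : 0 ≤ a)
    (hab : a ≤ b) :
    ∫⁻ ω in nearestInAnnulus X u a b, negExp (∑' k, interfExponent α R T u b (X k ω)) ∂P =
      ENNReal.ofReal (lam * Real.pi * (b ^ 2 - a ^ 2)) *
        negExp (ENNReal.ofReal (lam * Real.pi * b ^ 2) +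
          ENNReal.ofReal lam * interfMean α R T u b) := by
  set A := Metric.ball u b \ Metric.ball u a with hA
  have hAm : MeasurableSet A :=
    Metric.isOpen_ball.measurableSet.diff Metric.isOpen_ball.measurableSet
  have hBm : MeasurableSet (Metric.ball u a) := Metric.isOpen_ball.measurableSet
  set f : Plane → ℝ≥0∞ := fun y =>
    (Metric.ball u a).indicator (fun _ => (1 : ℝ≥0∞)) y * ∞ + interfExponent α R T u b y with hf
  have hfm : Measurable f :=
    ((measurable_const.indicator hBm).mul_const _).add (measurable_interfExponent α R T u b)
  have hreg : ∀ y, ‖y - u‖ < b → y ∉ interfRegion R u b := fun y hy h => absurd h.2 (not_le.2 hy)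
  have hfA : ∀ y ∈ A, f y = 0 := by
    intro y hy
    simp only [hf]
    rw [interfExponent, indicator_of_notMem hy.2,
      indicator_of_notMem (hreg y (mem_ball_iff_norm.1 hy.1))]
    simp
  have hlap := hX.setLIntegral_negExp_tsum hlam hAm hfm hfA
  have hsub : ∀ y, 1 - negExp (f y) = (Metric.ball u a).indicator (fun _ => (1 : ℝ≥0∞)) y +
      (interfRegion R u b).indicator (fun y => ENNReal.ofReal
        (interfRatio α T u b y / (1 + interfRatio α T u b y))) y := by
    intro y
    simp only [hf]
    by_cases hy : y ∈ Metric.ball u a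
    · rw [interfExponent, indicator_of_mem hy,
        indicator_of_notMem (hreg y ((mem_ball_iff_norm.1 hy).trans_le hab)),
        indicator_of_notMem (hreg y ((mem_ball_iff_norm.1 hy).trans_le hab))]
      simp
    · rw [indicator_of_notMem hy, interfExponent, zero_mul, zero_add, zero_add]
      by_cases hy' : y ∈ interfRegion R u b
      · rw [indicator_of_mem hy', indicator_of_mem hy',
          one_sub_negExp_log (interfRatio_nonneg hT (ha.trans hab) u y)]
      · simp [hy']
  have hleft : ∀ ω, negExp (∑' k, f (X k ω)) =
      {ω | pointCount X (Metric.ball u a) ω = 0}.indicator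
        (fun ω => negExp (∑' k, interfExponent α R T u b (X k ω))) ω := by
    intro ω
    simp only [hf]
    rw [ENNReal.tsum_add, ENNReal.tsum_mul_right, ← coe_pointCount, negExp_add]
    by_cases h0 : pointCount X (Metric.ball u a) ω = 0
    · rw [indicator_of_mem (by exact h0), h0]; simp
    · rw [indicator_of_notMem (by exact h0), ENNReal.mul_top (by simpa using h0)]; simp
  have hB0 : MeasurableSet {ω | pointCount X (Metric.ball u a) ω = 0} :=
    measurable_pointCount hX.measurable hBm (measurableSet_singleton 0)
  rw [lintegral_congr hleft, lintegral_indicator hB0, Measure.restrict_restrict hB0,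
    lintegral_congr hsub, lintegral_add_left (measurable_const.indicator hBm),
    lintegral_indicator_const hBm, one_mul, volume_ball_plane u ha] at hlap
  rw [show nearestInAnnulus X u a b = {ω | pointCount X (Metric.ball u a) ω = 0} ∩
    {ω | pointCount X A ω = 1} from rfl, hlap]
  have hlaw := hX.count_law A hAm
    (ne_top_of_le_ne_top measure_ball_lt_top.ne (measure_mono sdiff_subset)) 1
  rw [Nat.cast_one, volume_real_annulus u ha hab] at hlaw
  have hd : 0 ≤ b ^ 2 - a ^ 2 := by nlinarith
  have hpi := Real.pi_pos
  rw [hlaw, ← interfMean, mul_add, negExp_add, negExp_add, ← mul_assoc, ← mul_assoc,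
    ← ENNReal.ofReal_mul hlam.le, negExp_ofReal (by positivity), negExp_ofReal (by positivity),
    ← ENNReal.ofReal_mul (by positivity), ← mul_assoc (ENNReal.ofReal _) (ENNReal.ofReal _),
    ← ENNReal.ofReal_mul (by positivity)]
  congr 2
  -- The void probability of the ball and the exponential in the Poisson weight of the annulus
  -- combine into `exp (-lam π b²)`.
  rw [show -(lam * Real.pi * b ^ 2) = -(lam * (Real.pi * (b ^ 2 - a ^ 2))) +
    -(lam * (Real.pi * a ^ 2)) by ring, Real.exp_add]
  simp only [pow_one, Nat.factorial_one, Nat.cast_one, div_one]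
  ring_nf

end PoissonAnnulus

/-- The coverage probability of a user at `u` that is served at distance `a`. -/
def condCoverage (lam α R σ T : ℝ) (u : Plane) (a : ℝ) : ℝ≥0∞ :=
  negExp (ENNReal.ofReal (T * a ^ α * σ ^ 2) + ENNReal.ofReal lam * interfMean α R T u a)

lemma measurable_condCoverage {β : Type*} [MeasurableSpace β] (lam α R σ T : ℝ) {u : β → Plane}
    {a : β → ℝ} (hu : Measurable u) (ha : Measurable a) :
    Measurable fun b => condCoverage lam α R σ T (u b) (a b) := by
  unfold condCoverage
  refine measurable_negExp.comp (Measurable.add ?_ ((measurable_interfMean α R T hu ha).const_mul _))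
  exact (Measurable.mul_const (Measurable.const_mul (ha.pow_const α) T) _).ennreal_ofReal

lemma condCoverage_le_one (lam α R σ T : ℝ) (u : Plane) (a : ℝ) :
    condCoverage lam α R σ T u a ≤ 1 := negExp_le_one _

/-! ### From annuli to an integral over the serving distance. -/

section

variable {Ω : Type*} [MeasurableSpace Ω] {P : Measure Ω} [IsProbabilityMeasure P]
  {X : ℕ → Ω → Plane} {h : ℕ → Ω → ℂ}

lemma disjoint_nearestInAnnulus {Ω : Type*} (X : ℕ → Ω → Plane) (u : Plane) {a b a' b' : ℝ}
    (h : b ≤ a') : Disjoint (nearestInAnnulus X u a b) (nearestInAnnulus X u a' b') := by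
  refine Set.disjoint_left.2 fun ω hω hω' => ?_
  obtain ⟨n, -, hn, -⟩ := exists_unique_nearest hω
  have h0 := hω'.1
  rw [pointCount, encard_eq_zero] at h0
  have : n ∈ {n | X n ω ∈ Metric.ball u a'} := mem_ball_iff_norm.2 (hn.trans_le h)
  rw [h0] at this
  exact this

/-- The annulus events are disjoint, so at most one summand is nonzero for each configuration.
Configurations in none of the events, such as those with two points in the first occupied annulus,
are dropped. -/
lemma tsum_annuli_le_lintegral_prob_inCoverage {lam : ℝ} (hlam : 0 < lam)
    (hX : IsPoissonProcess P lam X) (hh : ∀ n, Measurable (h n))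
    (hh_law : ∀ n, P.map (h n) = complexGaussian) (hh_indep : iIndepFun h P)
    {α R σ T : ℝ} (hα : 0 < α) (hT : 0 < T) (u : Plane) {a : ℕ → ℝ} (ha0 : 0 < a 0)
    (ha : Monotone a) :
    ∑' j, ENNReal.ofReal (lam * Real.pi * (a (j + 1) ^ 2 - a j ^ 2)) *
        (negExp (ENNReal.ofReal (lam * Real.pi * a (j + 1) ^ 2)) *
          condCoverage lam α R σ T u (a (j + 1))) ≤
      ∫⁻ ω, P {ω' | InCoverage α R σ T (fun n => X n ω) (fun n => h n ω') u} ∂P := by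
  have hapos : ∀ j, 0 < a j := fun j => ha0.trans_le (ha (Nat.zero_le j))
  have hE := fun j => measurableSet_nearestInAnnulus hX.measurable u (a j) (a (j + 1))
  let F : ℕ → Ω → ℝ≥0∞ := fun j ω =>
    negExp (ENNReal.ofReal (T * a (j + 1) ^ α * σ ^ 2)) *
      negExp (∑' k, interfExponent α R T u (a (j + 1)) (X k ω))
  have hFm' : ∀ j, Measurable fun ω => negExp (∑' k, interfExponent α R T u (a (j + 1)) (X k ω)) :=
    fun j => measurable_negExp.comp (Measurable.tsum fun k =>
      (measurable_interfExponent α R T u _).comp (hX.measurable k))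
  have hFm : ∀ j, Measurable (F j) := fun j => (hFm' j).const_mul _
  have hterm : ∀ j, ENNReal.ofReal (lam * Real.pi * (a (j + 1) ^ 2 - a j ^ 2)) *
        (negExp (ENNReal.ofReal (lam * Real.pi * a (j + 1) ^ 2)) *
          condCoverage lam α R σ T u (a (j + 1))) =
      ∫⁻ ω, (nearestInAnnulus X u (a j) (a (j + 1))).indicator (F j) ω ∂P := by
    intro j
    rw [lintegral_indicator (hE j), lintegral_const_mul _ (hFm' j),
      setLIntegral_nearestInAnnulus hlam hX hT.le u (hapos j).le (ha (Nat.le_succ j)),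
      condCoverage, negExp_add, negExp_add]
    ring
  simp_rw [hterm]
  rw [← lintegral_tsum fun j => ((hFm j).indicator (hE j)).aemeasurable]
  refine lintegral_mono fun ω => ?_
  by_cases hω : ∃ j, ω ∈ nearestInAnnulus X u (a j) (a (j + 1))
  · obtain ⟨j, hj⟩ := hω
    rw [tsum_eq_single j, indicator_of_mem hj]
    · obtain ⟨n, hn1, hn2, hn3⟩ := exists_unique_nearest hj
      simp only [F]
      rw [← negExp_add]
      exact le_prob_inCoverage hh hh_law hh_indep hα hT (x := fun n => X n ω)
        ((hapos j).trans_le hn1) hn2 hn3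
    · intro i hij
      refine indicator_of_notMem (fun hi => ?_) _
      rcases lt_or_gt_of_ne hij with hlt | hlt
      · exact Set.disjoint_left.1 (disjoint_nearestInAnnulus X u (ha hlt)) hi hj
      · exact Set.disjoint_left.1 (disjoint_nearestInAnnulus X u (ha hlt)) hj hi
  · rw [ENNReal.tsum_eq_zero.2]
    · exact zero_le
    · exact fun j => indicator_of_notMem (fun hj => hω ⟨j, hj⟩) _

lemma setLIntegral_Ico_linear {c a b : ℝ} (hc : 0 ≤ c) (ha : 0 ≤ a) (hab : a ≤ b) :
    ∫⁻ r in Ico a b, ENNReal.ofReal (2 * c * r) = ENNReal.ofReal (c * (b ^ 2 - a ^ 2)) := by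
  rw [← ofReal_integral_eq_lintegral_ofReal]
  · rw [integral_Ico_eq_integral_Ioc, ← intervalIntegral.integral_of_le hab,
      intervalIntegral.integral_const_mul, integral_id]
    congr 1; ring
  · exact (Continuous.integrableOn_Icc (by fun_prop)).mono_set Ico_subset_Icc_self
  · refine (ae_restrict_iff' measurableSet_Ico).2 (Filter.Eventually.of_forall fun r hr => ?_)
    have : 0 ≤ r := ha.trans hr.1
    simp only [Pi.zero_apply]
    positivity

/-- A lower approximation, with mesh `δ`, of the density of coverage at serving distance `r`. -/
def meshDensity (lam α R σ T : ℝ) (u : Plane) (δ r : ℝ) : ℝ≥0∞ :=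
  ENNReal.ofReal (2 * (lam * Real.pi) * r) *
    (negExp (ENNReal.ofReal (lam * Real.pi * (r + δ) ^ 2)) *
      negExp (ENNReal.ofReal (T * (r + δ) ^ α * σ ^ 2) +
        ENNReal.ofReal lam * (ENNReal.ofReal (((r + δ) / r) ^ α) * interfMean α R T u r)))

lemma measurable_meshDensity (lam α R σ T : ℝ) (u : Plane) (δ : ℝ) :
    Measurable (meshDensity lam α R σ T u δ) := by
  have h1 : Measurable fun r => interfMean α R T u r :=
    measurable_interfMean α R T measurable_const measurable_id
  unfold meshDensity
  refine Measurable.mul (by fun_prop) (Measurable.mul (measurable_negExp.comp (by fun_prop))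
    (measurable_negExp.comp (Measurable.add (by fun_prop) (Measurable.const_mul
      (Measurable.mul (by fun_prop) h1) _))))

/-- The weight `lam π (b² - a²)` of an annulus is the integral of `2 lam π r` over its cell. There
the upper endpoint is at most `r + δ`, so the density stays below the corresponding annulus term. -/
lemma setLIntegral_meshDensity_le {lam : ℝ} (hlam : 0 < lam)
    (hX : IsPoissonProcess P lam X) (hh : ∀ n, Measurable (h n))
    (hh_law : ∀ n, P.map (h n) = complexGaussian) (hh_indep : iIndepFun h P)
    {α R σ T : ℝ} (hα : 0 < α) (hT : 0 < T) (u : Plane) {δ : ℝ} (hδ : 0 < δ) :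
    ∫⁻ r in Ici δ, meshDensity lam α R σ T u δ r ≤
      ∫⁻ ω, P {ω' | InCoverage α R σ T (fun n => X n ω) (fun n => h n ω') u} ∂P := by
  -- The grid starts at `δ` because the first radius must be positive. The cell containing `r`
  -- therefore has index `⌊r / δ⌋ - 1`.
  set a : ℕ → ℝ := fun j => (j + 1) * δ with ha
  have hamono : Monotone a := fun i j hij => by
    have : (i : ℝ) ≤ j := by exact_mod_cast hij
    simp only [ha]; gcongr
  have hapos : ∀ j, 0 < a j := fun j => by simp only [ha]; positivity
  have hasucc : ∀ j, a (j + 1) = a j + δ := fun j => by simp only [ha]; push_cast; ring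
  refine le_trans ?_ (tsum_annuli_le_lintegral_prob_inCoverage hlam hX hh hh_law hh_indep hα hT u
    (hapos 0) hamono)
  have hcover : Ici δ ⊆ ⋃ j, Ico (a j) (a (j + 1)) := by
    intro r hr
    have hr1 : 1 ≤ r / δ := (one_le_div hδ).2 hr
    have hfl : 1 ≤ ⌊r / δ⌋₊ := Nat.one_le_floor_iff _ |>.2 hr1
    refine mem_iUnion.2 ⟨⌊r / δ⌋₊ - 1, ?_, ?_⟩
    · simp only [ha]
      rw [← le_div_iff₀ hδ, Nat.cast_sub hfl]
      simpa using Nat.floor_le (by positivity)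
    · simp only [ha]
      rw [← div_lt_iff₀ hδ, Nat.sub_add_cancel hfl]
      exact Nat.lt_floor_add_one _
  refine (lintegral_mono_set hcover).trans ((lintegral_iUnion_le _ _).trans
    (ENNReal.tsum_le_tsum fun j => ?_))
  rw [← setLIntegral_Ico_linear (by positivity) (hapos j).le (hamono (Nat.le_succ j)),
    ← lintegral_mul_const _ (by fun_prop)]
  refine setLIntegral_mono ((by fun_prop : Measurable _).mul_const _) fun r hr => ?_
  have hr0 : 0 < r := (hapos j).trans_le hr.1
  have hle : a (j + 1) ≤ r + δ := by rw [hasucc]; linarith [hr.1]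
  have hpos := hapos (j + 1)
  have hpi := Real.pi_pos
  rw [meshDensity]
  gcongr
  · refine negExp_antitone (ENNReal.ofReal_le_ofReal ?_)
    gcongr
  · refine negExp_antitone (add_le_add (ENNReal.ofReal_le_ofReal ?_) ?_)
    · gcongr
    · gcongr
      refine (interfMean_le hα hT.le R u hr0 hr.2.le).trans ?_
      gcongr

/-- The mesh `δ` does not enter `interfMean`, so only powers of `r + δ` need to converge. -/
lemma tendsto_meshDensity (lam α R σ T : ℝ) (hα : 0 < α) (u : Plane) {r : ℝ} (hr : 0 < r) :
    Filter.Tendsto (fun δ => meshDensity lam α R σ T u δ r) (nhds 0)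
      (nhds (ENNReal.ofReal (2 * (lam * Real.pi) * r) *
        (negExp (ENNReal.ofReal (lam * Real.pi * r ^ 2)) * condCoverage lam α R σ T u r))) := by
  have h1 : Filter.Tendsto (fun δ : ℝ => r + δ) (nhds 0) (nhds r) := by
    have := (continuous_const_add r).tendsto (0 : ℝ)
    simpa using this
  have h2 : Filter.Tendsto (fun δ : ℝ => (r + δ) ^ α) (nhds 0) (nhds (r ^ α)) :=
    h1.rpow_const (Or.inr hα.le)
  have h3 : Filter.Tendsto (fun δ : ℝ => ((r + δ) / r) ^ α) (nhds 0) (nhds 1) := by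
    have := (h1.div_const r).rpow_const (p := α) (Or.inr hα.le)
    simpa [div_self hr.ne'] using this
  have h4 : Filter.Tendsto (fun δ : ℝ => ENNReal.ofReal (((r + δ) / r) ^ α) * interfMean α R T u r)
      (nhds 0) (nhds (interfMean α R T u r)) := by
    have := ENNReal.Tendsto.mul_const (b := interfMean α R T u r) (ENNReal.tendsto_ofReal h3)
      (Or.inl (by simp))
    simpa using this
  have h5 := ENNReal.Tendsto.const_mul (a := ENNReal.ofReal lam) h4 (Or.inr ENNReal.ofReal_ne_top)
  have h6 := (ENNReal.tendsto_ofReal ((h2.const_mul T).mul_const (σ ^ 2))).add h5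
  have h7 := (continuous_negExp.tendsto _).comp h6
  have h8 := (continuous_negExp.tendsto _).comp
    (ENNReal.tendsto_ofReal ((h1.pow 2).const_mul (lam * Real.pi)))
  have hne : ∀ x, negExp x ≠ ∞ := fun x => ne_top_of_le_ne_top ENNReal.one_ne_top (negExp_le_one x)
  exact ENNReal.Tendsto.const_mul (ENNReal.Tendsto.mul h8 (Or.inr (hne _)) h7 (Or.inr (hne _)))
    (Or.inr ENNReal.ofReal_ne_top)

lemma lintegral_nearestDistLaw {lam : ℝ} {φ : ℝ → ℝ≥0∞} (hφ : Measurable φ) :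
    ∫⁻ r, φ r ∂(nearestDistLaw lam) =
      ∫⁻ r in Ioi 0, ENNReal.ofReal (2 * Real.pi * lam * r * Real.exp (-(lam * Real.pi * r ^ 2))) *
        φ r := by
  have hm : Measurable fun r : ℝ =>
      ENNReal.ofReal (2 * Real.pi * lam * r * Real.exp (-(lam * Real.pi * r ^ 2))) := by fun_prop
  rw [nearestDistLaw, lintegral_withDensity_eq_lintegral_mul _ (hm.indicator measurableSet_Ici) hφ,
    setLIntegral_congr Ioi_ae_eq_Ici, ← lintegral_indicator measurableSet_Ici]
  refine lintegral_congr fun r => ?_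
  by_cases hr : r ∈ Ici (0 : ℝ)
  · simp [indicator_of_mem hr]
  · simp [indicator_of_notMem hr]

/-- Fatou's lemma along a null sequence of meshes; the excluded intervals below `δ m` disappear in
the pointwise limit on `r > 0`. -/
lemma lintegral_condCoverage_le_of_mesh {lam α R σ T : ℝ} (hlam : 0 < lam) (hα : 0 < α) (u : Plane)
    {Q : ℝ≥0∞} (hQ : ∀ δ, 0 < δ → ∫⁻ r in Ici δ, meshDensity lam α R σ T u δ r ≤ Q)
    {δ : ℕ → ℝ} (hδpos : ∀ m, 0 < δ m) (hδ0 : Filter.Tendsto δ Filter.atTop (nhds 0)) :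
    ∫⁻ r, condCoverage lam α R σ T u r ∂(nearestDistLaw lam) ≤ Q := by
  have hbound : ∀ m, ∫⁻ r in Ioi 0, (Ici (δ m)).indicator (meshDensity lam α R σ T u (δ m)) r ≤
      Q := by
    intro m
    rw [lintegral_indicator measurableSet_Ici]
    exact (lintegral_mono' (Measure.restrict_mono le_rfl Measure.restrict_le_self) le_rfl).trans
      (hQ _ (hδpos m))
  have hmeas : ∀ m, Measurable ((Ici (δ m)).indicator (meshDensity lam α R σ T u (δ m))) :=
    fun m => (measurable_meshDensity lam α R σ T u (δ m)).indicator measurableSet_Ici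
  have hlim : ∀ r ∈ Ioi (0 : ℝ),
      ENNReal.ofReal (2 * Real.pi * lam * r * Real.exp (-(lam * Real.pi * r ^ 2))) *
        condCoverage lam α R σ T u r =
      Filter.liminf (fun m => (Ici (δ m)).indicator (meshDensity lam α R σ T u (δ m)) r)
        Filter.atTop := by
    intro r hr
    have hr0 : 0 < r := hr
    have hpi := Real.pi_pos
    refine (Filter.Tendsto.liminf_eq ?_).symm
    have h1 := (tendsto_meshDensity lam α R σ T hα u hr0).comp hδ0
    rw [negExp_ofReal (by positivity), ← mul_assoc, ← ENNReal.ofReal_mul (by positivity),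
      show 2 * (lam * Real.pi) * r = 2 * Real.pi * lam * r by ring] at h1
    refine h1.congr' ?_
    filter_upwards [hδ0.eventually (ge_mem_nhds hr0)] with m hm
    have hm' : r ∈ Ici (δ m) := hm
    rw [indicator_of_mem hm', Function.comp_apply]
  have hcm : Measurable fun r => condCoverage lam α R σ T u r :=
    measurable_condCoverage lam α R σ T measurable_const measurable_id
  rw [lintegral_nearestDistLaw hcm, setLIntegral_congr_fun measurableSet_Ioi hlim]
  exact (lintegral_liminf_le hmeas).trans
    (Filter.liminf_le_of_frequently_le' (Filter.Frequently.of_forall hbound))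

/-- A user at `u` is in coverage with at least the probability obtained by averaging the coverage
probability given the serving distance. -/
lemma lintegral_condCoverage_le {lam : ℝ} (hlam : 0 < lam)
    (hX : IsPoissonProcess P lam X) (hh : ∀ n, Measurable (h n))
    (hh_law : ∀ n, P.map (h n) = complexGaussian) (hh_indep : iIndepFun h P)
    {α R σ T : ℝ} (hα : 0 < α) (hT : 0 < T) (u : Plane) :
    ∫⁻ r, condCoverage lam α R σ T u r ∂(nearestDistLaw lam) ≤
      ∫⁻ ω, P {ω' | InCoverage α R σ T (fun n => X n ω) (fun n => h n ω') u} ∂P :=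
  lintegral_condCoverage_le_of_mesh hlam hα u
    (fun _ hδ => setLIntegral_meshDensity_le hlam hX hh hh_law hh_indep hα hT u hδ)
    (δ := fun m : ℕ => 1 / ((m : ℝ) + 1)) (fun m => by positivity)
    tendsto_one_div_add_atTop_nhds_zero_nat

end

/-! ### The radial integral -/

/-- The integral of the interference density along a ray from the user, beyond the distance `l`. -/
def radialTail (α T a l : ℝ) : ℝ≥0∞ :=
  ∫⁻ r in Ioi l, ENNReal.ofReal r *
    ENNReal.ofReal (T * a ^ α * r ^ (-α) / (1 + T * a ^ α * r ^ (-α)))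

/-- The closed form `T a ^ α l ^ (2 - α) Λ(a / l, T) / (α - 2)` of the radial integral. -/
def radialValue (α T a l : ℝ) : ℝ := T * a ^ α * l ^ (2 - α) * bigLambda α (a / l) T / (α - 2)

/-- Here `c - b = 1`, so the power of `1 - t` disappears and the Gamma quotient reduces to `b = (α -
2) / α`. -/
lemma bigLambda_eq {α ρ T : ℝ} (hα : 2 < α) (hρ : 0 ≤ ρ) (hT : 0 ≤ T) :
    bigLambda α ρ T = (α - 2) / α * ∫ t in Ioo (0 : ℝ) 1, t ^ (-(2 / α)) * (1 + ρ ^ α * T * t)⁻¹ := by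
  have hα0 : 0 < α := by linarith
  have hb : 0 < (α - 2) / α := div_pos (by linarith) hα0
  have hb1 : (α - 2) / α - 1 = -(2 / α) := by field_simp; ring
  have hc : 2 - 2 / α = (α - 2) / α + 1 := by field_simp; ring
  rw [bigLambda, hyp2F1, hc, Real.Gamma_add_one hb.ne', add_sub_cancel_left, Real.Gamma_one, mul_one,
    mul_div_cancel_right₀ _ (Real.Gamma_pos_of_pos hb).ne',
    intervalIntegral.integral_of_le zero_le_one, integral_Ioc_eq_integral_Ioo, hb1]
  congr 1
  refine setIntegral_congr_fun measurableSet_Ioo fun t ht => ?_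
  have h1 : 0 ≤ ρ ^ α * T * t := mul_nonneg (by positivity) ht.1.le
  simp only [sub_self, Real.rpow_zero, mul_one, neg_mul, sub_neg_eq_add, Real.rpow_neg_one]

lemma bigLambda_nonneg {α ρ T : ℝ} (hα : 2 < α) (hρ : 0 ≤ ρ) (hT : 0 ≤ T) :
    0 ≤ bigLambda α ρ T := by
  rw [bigLambda_eq hα hρ hT]
  refine mul_nonneg (div_nonneg (by linarith) (by linarith))
    (setIntegral_nonneg measurableSet_Ioo fun t ht => ?_)
  have := ht.1
  positivity

lemma radialValue_nonneg {α T a l : ℝ} (hα : 2 < α) (hT : 0 ≤ T) (ha : 0 ≤ a) (hl : 0 ≤ l) :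
    0 ≤ radialValue α T a l := by
  have := bigLambda_nonneg hα (div_nonneg ha hl) hT
  have : 0 < α - 2 := by linarith
  unfold radialValue
  positivity

/-- The singularity at `0` is integrable because `2 / α < 1`; it corresponds to convergence of the
interference at infinity. -/
lemma integrableOn_euler {α κ : ℝ} (hα : 2 < α) (hκ : 0 ≤ κ) :
    IntegrableOn (fun t : ℝ => t ^ (-(2 / α)) * (1 + κ * t)⁻¹) (Ioo 0 1) := by
  have h1 : IntegrableOn (fun t : ℝ => t ^ (-(2 / α))) (Ioo 0 1) := by
    rw [intervalIntegral.integrableOn_Ioo_rpow_iff one_pos, neg_lt_neg_iff, div_lt_one (by linarith)]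
    exact hα
  have hm : Measurable fun t : ℝ => t ^ (-(2 / α)) * (1 + κ * t)⁻¹ := by fun_prop
  refine Integrable.mono h1 hm.aestronglyMeasurable ?_
  refine (ae_restrict_iff' measurableSet_Ioo).2 (Filter.Eventually.of_forall fun t ht => ?_)
  have h0 : 0 ≤ κ * t := mul_nonneg hκ ht.1.le
  rw [norm_mul]
  refine mul_le_of_le_one_right (norm_nonneg _) ?_
  rw [norm_inv, Real.norm_of_nonneg (by linarith)]
  exact inv_le_one_of_one_le₀ (by linarith)

lemma image_rpow_Ioo {α l : ℝ} (hα : 0 < α) (hl : 0 < l) :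
    (fun t : ℝ => l * t ^ (-(1 / α))) '' Ioo 0 1 = Ioi l := by
  ext r
  constructor
  · rintro ⟨t, ht, rfl⟩
    have : 1 < t ^ (-(1 / α)) :=
      Real.one_lt_rpow_of_pos_of_lt_one_of_neg ht.1 ht.2 (by simpa using hα)
    exact lt_mul_of_one_lt_right hl this
  · intro hr
    have hr' : l < r := hr
    have hr0 : 0 < r := hl.trans hr'
    refine ⟨(r / l) ^ (-α), ⟨by positivity,
      Real.rpow_lt_one_of_one_lt_of_neg ((one_lt_div hl).2 hr') (by linarith)⟩, ?_⟩
    simp only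
    rw [← Real.rpow_mul (by positivity)]
    have : -α * -(1 / α) = 1 := by field_simp
    rw [this, Real.rpow_one]
    field_simp

/-- Substituting `r = l t ^ (-1 / α)` turns `T (a / r) ^ α` into `κ t` with `κ = T (a / l) ^ α`,
which leaves Euler's integral. -/
lemma radialTail_eq {α T a l : ℝ} (hα : 2 < α) (hT : 0 ≤ T) (ha : 0 ≤ a) (hl : 0 < l) :
    radialTail α T a l = ENNReal.ofReal (radialValue α T a l) := by
  have hα0 : 0 < α := by linarith
  have hinj : InjOn (fun t : ℝ => l * t ^ (-(1 / α))) (Ioo 0 1) := by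
    intro s hs t ht hst
    have h1 : s ^ (-(1 / α)) = t ^ (-(1 / α)) := mul_left_cancel₀ hl.ne' hst
    exact (Real.rpow_left_inj hs.1.le ht.1.le (by simpa using hα0.ne')).1 h1
  have hderiv : ∀ t ∈ Ioo (0 : ℝ) 1, HasDerivWithinAt (fun t : ℝ => l * t ^ (-(1 / α)))
      (l * (-(1 / α) * t ^ (-(1 / α) - 1))) (Ioo 0 1) t := fun t ht =>
    ((Real.hasDerivAt_rpow_const (Or.inl ht.1.ne')).const_mul l).hasDerivWithinAt
  rw [radialTail, ← image_rpow_Ioo hα0 hl,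
    lintegral_image_eq_lintegral_abs_deriv_mul measurableSet_Ioo hderiv hinj]
  set κ : ℝ := (a / l) ^ α * T with hκ
  have hκ0 : 0 ≤ κ := by positivity
  have hκl : T * a ^ α * l ^ (-α) = κ := by
    rw [hκ, Real.div_rpow ha hl.le, Real.rpow_neg hl.le]
    field_simp
  have hpt : ∀ t ∈ Ioo (0 : ℝ) 1, ENNReal.ofReal |l * (-(1 / α) * t ^ (-(1 / α) - 1))| *
      (ENNReal.ofReal (l * t ^ (-(1 / α))) * ENNReal.ofReal
        (T * a ^ α * (l * t ^ (-(1 / α))) ^ (-α) / (1 + T * a ^ α * (l * t ^ (-(1 / α))) ^ (-α)))) =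
      ENNReal.ofReal (l ^ 2 * κ / α * (t ^ (-(2 / α)) * (1 + κ * t)⁻¹)) := by
    intro t ht
    have ht0 := ht.1
    have h1 : T * a ^ α * (l * t ^ (-(1 / α))) ^ (-α) = κ * t := by
      rw [Real.mul_rpow hl.le (by positivity), ← Real.rpow_mul ht0.le, ← mul_assoc, hκl]
      have : -(1 / α) * -α = 1 := by field_simp
      rw [this, Real.rpow_one]
    have h2 : |l * (-(1 / α) * t ^ (-(1 / α) - 1))| = l * (1 / α * t ^ (-(1 / α) - 1)) := by
      rw [neg_mul, mul_neg, abs_neg, abs_of_nonneg (by positivity)]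
    have h3 : t ^ (-(1 / α) - 1) * t ^ (-(1 / α)) * t = t ^ (-(2 / α)) := by
      nth_rewrite 3 [← Real.rpow_one t]
      rw [← Real.rpow_add ht0, ← Real.rpow_add ht0]
      congr 1
      ring
    rw [h1, h2, ← ENNReal.ofReal_mul (by positivity), ← ENNReal.ofReal_mul (by positivity), ← h3]
    congr 1
    have : 1 + κ * t ≠ 0 := by positivity
    field_simp
  rw [setLIntegral_congr_fun measurableSet_Ioo hpt, ← ofReal_integral_eq_lintegral_ofReal
    ((integrableOn_euler hα hκ0).const_mul _)
    ((ae_restrict_iff' measurableSet_Ioo).2 (Filter.Eventually.of_forall fun t ht => by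
      have := ht.1
      simp only [Pi.zero_apply]
      positivity)), integral_const_mul, radialValue, bigLambda_eq hα (by positivity) hT, ← hκ]
  congr 1
  have h4 : T * a ^ α * l ^ (2 - α) = κ * l ^ 2 := by
    rw [← hκl, sub_eq_add_neg, Real.rpow_add hl]
    norm_cast
    ring
  rw [h4]
  have : α - 2 ≠ 0 := by linarith
  field_simp

lemma radialTail_antitone (α T a : ℝ) : Antitone (radialTail α T a) := fun _ _ h =>
  lintegral_mono_set (Ioi_subset_Ioi h)

/-! ### The cluster seen from the user -/

/-- `R'` is the larger root in `r` of `ρ² + 2 ρ r cos θ + r² = R²`. By the law of cosines the left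
side is the squared distance from `O` of the point at distance `r` and angle `θ` from the user. -/
lemma bdryDist_lt_iff {R ρ : ℝ} (hρ : 0 ≤ ρ) (hρR : ρ ≤ R) {r : ℝ} (hr : 0 < r) (θ : ℝ) :
    bdryDist R ρ θ < r ↔ R ^ 2 < ρ ^ 2 + 2 * ρ * r * Real.cos θ + r ^ 2 := by
  have hD : (Real.cos θ * ρ) ^ 2 ≤ Real.cos θ ^ 2 * ρ ^ 2 - ρ ^ 2 + R ^ 2 := by nlinarith
  rw [bdryDist, sub_lt_iff_lt_add]
  constructor
  · intro h
    have h0 := (Real.sqrt_nonneg _).trans_lt h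
    have := (Real.sqrt_lt' h0).1 h
    nlinarith
  · intro h
    have h0 : 0 < r + Real.cos θ * ρ := by
      by_contra hneg
      nlinarith
    exact (Real.sqrt_lt' h0).2 (by nlinarith)

lemma bdryDist_le_iff {R ρ : ℝ} (hρ : 0 ≤ ρ) (hρR : ρ ≤ R) {r : ℝ} (hr : 0 < r) (θ : ℝ) :
    bdryDist R ρ θ ≤ r ↔ R ^ 2 ≤ ρ ^ 2 + 2 * ρ * r * Real.cos θ + r ^ 2 := by
  have hD : (Real.cos θ * ρ) ^ 2 ≤ Real.cos θ ^ 2 * ρ ^ 2 - ρ ^ 2 + R ^ 2 := by nlinarith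
  rw [bdryDist, sub_le_iff_le_add]
  constructor
  · intro h
    have h0 := (Real.sqrt_nonneg _).trans h
    have := (Real.sqrt_le_left h0).1 h
    nlinarith
  · intro h
    have h0 : 0 ≤ r + Real.cos θ * ρ := by
      by_contra hneg
      nlinarith
    exact (Real.sqrt_le_left h0).2 (by nlinarith)

lemma continuous_bdryDist (R ρ : ℝ) : Continuous (bdryDist R ρ) := by
  unfold bdryDist; fun_prop

/-- Aligning the real axis with `u` makes the polar angle the angle from the outward radial
direction. -/
lemma exists_isometry_complex_plane (u : Plane) :
    ∃ L : ℂ ≃ₗᵢ[ℝ] Plane, L (‖u‖ : ℂ) = u := by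
  let L₀ : ℂ ≃ₗᵢ[ℝ] Plane := Complex.orthonormalBasisOneI.repr
  let z := L₀.symm u
  have hz : ‖z‖ = ‖u‖ := L₀.symm.norm_map u
  refine ⟨(rotation (Circle.exp z.arg)).trans L₀, ?_⟩
  have : rotation (Circle.exp z.arg) (‖u‖ : ℂ) = z := by
    rw [rotation_apply, Circle.coe_exp, ← hz, mul_comm]
    exact Complex.norm_mul_exp_arg_mul_I z
  rw [LinearIsometryEquiv.trans_apply, this]
  exact L₀.apply_symm_apply u

lemma sq_norm_add_polar (ρ r θ : ℝ) :
    ‖(r * (Real.cos θ + Real.sin θ * Complex.I) + ρ : ℂ)‖ ^ 2 =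
      ρ ^ 2 + 2 * ρ * r * Real.cos θ + r ^ 2 := by
  rw [← Complex.normSq_eq_norm_sq, Complex.normSq_apply]
  simp only [Complex.add_re, Complex.mul_re, Complex.ofReal_re, Complex.I_re, mul_zero,
    Complex.ofReal_im, Complex.I_im, mul_one, sub_self, add_zero, Complex.add_im, Complex.mul_im,
    zero_mul, sub_zero, zero_add]
  linear_combination r ^ 2 * Real.sin_sq_add_cos_sq θ

/-- The interference integral in polar coordinates around the user. -/
lemma interfMean_eq_lintegral_radialTail {α R T : ℝ} {u : Plane} (hu : ‖u‖ ≤ R) {a : ℝ}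
    (ha : 0 < a) :
    interfMean α R T u a =
      ∫⁻ θ in Ioo (-Real.pi) Real.pi, radialTail α T a (max a (bdryDist R ‖u‖ θ)) := by
  obtain ⟨L, hL⟩ := exists_isometry_complex_plane u
  have hmp : MeasurePreserving (fun z : ℂ => L z + u) volume volume :=
    (measurePreserving_add_right volume u).comp L.measurePreserving
  set q : ℝ → ℝ≥0∞ := fun r => ENNReal.ofReal (T * a ^ α * r ^ (-α) / (1 + T * a ^ α * r ^ (-α)))
    with hq
  have hqm : Measurable q := by fun_prop
  have hR : 0 ≤ R := (norm_nonneg u).trans hu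
  have hmS : Measurable ((interfRegion R u a).indicator
      (fun y => ENNReal.ofReal (interfRatio α T u a y / (1 + interfRatio α T u a y)))) :=
    (((measurable_interfRatio α T u a).div
      ((measurable_interfRatio α T u a).const_add 1)).ennreal_ofReal).indicator
      (measurableSet_interfRegion R u a)
  have h1 : ∀ z : ℂ, (interfRegion R u a).indicator
      (fun y => ENNReal.ofReal (interfRatio α T u a y / (1 + interfRatio α T u a y))) (L z + u) =
      {z : ℂ | R < ‖z + ‖u‖‖ ∧ a ≤ ‖z‖}.indicator (fun z => q ‖z‖) z := by
    intro z
    have hn : ‖L z + u - u‖ = ‖z‖ := by rw [add_sub_cancel_right, L.norm_map]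
    have hn' : ‖L z + u‖ = ‖z + ‖u‖‖ := by
      rw [← L.norm_map (z + ‖u‖), map_add, hL]
    have hiff : L z + u ∈ interfRegion R u a ↔ z ∈ {z : ℂ | R < ‖z + ‖u‖‖ ∧ a ≤ ‖z‖} := by
      simp only [interfRegion, cluster, Metric.mem_closedBall, dist_zero_right, mem_ofPred_eq,
        hn, hn', not_le]
    by_cases hz : z ∈ {z : ℂ | R < ‖z + ‖u‖‖ ∧ a ≤ ‖z‖}
    · rw [indicator_of_mem hz, indicator_of_mem (hiff.2 hz), interfRatio, hn]
    · rw [indicator_of_notMem hz, indicator_of_notMem (fun h => hz (hiff.1 h))]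
  have hset : MeasurableSet {p : ℝ × ℝ | bdryDist R ‖u‖ p.2 < p.1 ∧ a ≤ p.1} :=
    (measurableSet_lt ((continuous_bdryDist R ‖u‖).measurable.comp measurable_snd)
      measurable_fst).inter (measurableSet_le measurable_const measurable_fst)
  rw [interfMean, ← hmp.lintegral_comp hmS, lintegral_congr h1,
    ← Complex.lintegral_comp_polarCoord_symm]
  have h2 : ∀ p ∈ polarCoord.target, ENNReal.ofReal p.1 •
      {z : ℂ | R < ‖z + ‖u‖‖ ∧ a ≤ ‖z‖}.indicator (fun z => q ‖z‖) (Complex.polarCoord.symm p) =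
      {p : ℝ × ℝ | bdryDist R ‖u‖ p.2 < p.1 ∧ a ≤ p.1}.indicator
        (fun p => ENNReal.ofReal p.1 * q p.1) p := by
    rintro ⟨r, θ⟩ hp
    have hr : 0 < r := hp.1
    have hn : ‖Complex.polarCoord.symm (r, θ)‖ = r := by
      rw [Complex.norm_polarCoord_symm, abs_of_pos hr]
    have hiff : Complex.polarCoord.symm (r, θ) ∈ {z : ℂ | R < ‖z + ‖u‖‖ ∧ a ≤ ‖z‖} ↔
        (r, θ) ∈ {p : ℝ × ℝ | bdryDist R ‖u‖ p.2 < p.1 ∧ a ≤ p.1} := by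
      simp only [mem_ofPred_eq, hn]
      rw [bdryDist_lt_iff (norm_nonneg u) hu hr, ← sq_norm_add_polar, sq_lt_sq₀ hR (norm_nonneg _),
        Complex.polarCoord_symm_apply]
    by_cases hz : (r, θ) ∈ {p : ℝ × ℝ | bdryDist R ‖u‖ p.2 < p.1 ∧ a ≤ p.1}
    · rw [indicator_of_mem hz, indicator_of_mem (hiff.2 hz), hn, smul_eq_mul]
    · rw [indicator_of_notMem hz, indicator_of_notMem (fun h => hz (hiff.1 h)), smul_zero]
  rw [setLIntegral_congr_fun polarCoord.open_target.measurableSet h2]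
  have htar : polarCoord.target = Ioi (0 : ℝ) ×ˢ Ioo (-Real.pi) Real.pi := rfl
  have hfm : Measurable fun p : ℝ × ℝ => ENNReal.ofReal p.1 * q p.1 := by fun_prop
  rw [htar, Measure.volume_eq_prod, ← Measure.prod_restrict,
    lintegral_prod_symm _ (hfm.indicator hset).aemeasurable]
  refine lintegral_congr fun θ => ?_
  have h3 : ∀ r, {p : ℝ × ℝ | bdryDist R ‖u‖ p.2 < p.1 ∧ a ≤ p.1}.indicator
        (fun p => ENNReal.ofReal p.1 * q p.1) (r, θ) =
      (Ioi (bdryDist R ‖u‖ θ) ∩ Ici a).indicator (fun r => ENNReal.ofReal r * q r) r := fun r => rfl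
  have hs : MeasurableSet (Ioi (bdryDist R ‖u‖ θ) ∩ Ici a) :=
    measurableSet_Ioi.inter measurableSet_Ici
  -- Along each ray, interferers lie beyond both the cluster boundary and the serving distance;
  -- whence the maximum as lower limit.
  have hsub : Ioi (bdryDist R ‖u‖ θ) ∩ Ici a ∩ Ioi 0 = Ioi (bdryDist R ‖u‖ θ) ∩ Ici a :=
    inter_eq_left.2 fun r hr => ha.trans_le hr.2
  rw [lintegral_congr h3, lintegral_indicator hs, Measure.restrict_restrict hs, hsub, radialTail,
    max_comm, ← Ioi_inter_Ioi]
  exact setLIntegral_congr ((ae_eq_refl _).inter Ioi_ae_eq_Ici.symm)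

/-- The base angle `c` is free by periodicity: `P₁` uses `0` and `P₂` uses `-Θ`. Integrability holds
since the radial tail is largest at `l = a`. -/
lemma interfMean_eq_ofReal {α R T : ℝ} (hα : 2 < α) (hT : 0 ≤ T) {u : Plane} (hu : ‖u‖ ≤ R) {a : ℝ}
    (ha : 0 < a) (c : ℝ) :
    IntervalIntegrable (fun θ => radialValue α T a (max a (bdryDist R ‖u‖ θ))) volume c
        (c + 2 * Real.pi) ∧
      interfMean α R T u a = ENNReal.ofReal
        (∫ θ in c..(c + 2 * Real.pi), radialValue α T a (max a (bdryDist R ‖u‖ θ))) := by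
  set g : ℝ → ℝ := fun θ => radialValue α T a (max a (bdryDist R ‖u‖ θ)) with hg
  have hmax : ∀ θ, 0 < max a (bdryDist R ‖u‖ θ) := fun θ => lt_max_of_lt_left ha
  have hg0 : ∀ θ, 0 ≤ g θ := fun θ => radialValue_nonneg hα hT ha.le (hmax θ).le
  have htail : ∀ θ, radialTail α T a (max a (bdryDist R ‖u‖ θ)) = ENNReal.ofReal (g θ) :=
    fun θ => radialTail_eq hα hT ha.le (hmax θ)
  have hgt : g = fun θ => (radialTail α T a (max a (bdryDist R ‖u‖ θ))).toReal := by
    ext θ; rw [htail, ENNReal.toReal_ofReal (hg0 θ)]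
  have hgm : Measurable g := by
    rw [hgt]
    exact ((radialTail_antitone α T a).measurable.comp
      (measurable_const.max (continuous_bdryDist R ‖u‖).measurable)).ennreal_toReal
  have hgle : ∀ θ, g θ ≤ radialValue α T a a := by
    intro θ
    have h1 := radialTail_antitone α T a (le_max_left a (bdryDist R ‖u‖ θ))
    rw [htail, radialTail_eq hα hT ha.le ha] at h1
    exact (ENNReal.ofReal_le_ofReal_iff (radialValue_nonneg hα hT ha.le ha.le)).1 h1
  have hper : Function.Periodic g (2 * Real.pi) := by
    intro θ
    simp only [hg, bdryDist, Real.cos_add_two_pi]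
  have hint : ∀ x y, IntervalIntegrable g volume x y := by
    intro x y
    refine (intervalIntegrable_const (c := radialValue α T a a)).mono_fun
      hgm.aestronglyMeasurable (Filter.Eventually.of_forall fun θ => ?_)
    simp only
    rw [Real.norm_of_nonneg (hg0 θ), Real.norm_of_nonneg (radialValue_nonneg hα hT ha.le ha.le)]
    exact hgle θ
  refine ⟨hint _ _, ?_⟩
  have hpi := Real.pi_pos
  rw [hper.intervalIntegral_add_eq c (-Real.pi), show -Real.pi + 2 * Real.pi = Real.pi by ring,
    interfMean_eq_lintegral_radialTail hu ha, intervalIntegral.integral_of_le (by linarith),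
    integral_Ioc_eq_integral_Ioo, ofReal_integral_eq_lintegral_ofReal]
  · exact lintegral_congr htail
  · exact (intervalIntegrable_iff_integrableOn_Ioo_of_le (by linarith)).1 (hint _ _)
  · exact Filter.Eventually.of_forall hg0

lemma condCoverage_eq_ofReal {lam α R σ T : ℝ} (hlam : 0 ≤ lam) (hT : 0 ≤ T) {u : Plane} {a : ℝ}
    (ha : 0 ≤ a) {J : ℝ} (hJ : 0 ≤ J) (hJ' : interfMean α R T u a = ENNReal.ofReal J) :
    condCoverage lam α R σ T u a =
      ENNReal.ofReal (Real.exp (-(T * a ^ α * σ ^ 2)) * Real.exp (-(lam * J))) := by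
  rw [condCoverage, hJ', negExp_add, ← ENNReal.ofReal_mul hlam, negExp_ofReal (by positivity),
    negExp_ofReal (by positivity), ENNReal.ofReal_mul (by positivity)]

/-- The ball of radius `a` around the user lies inside the cluster, so every ray of interferers
starts at the cluster boundary. -/
lemma condCoverage_eq_P₁ {lam α R σ T : ℝ} (hlam : 0 ≤ lam) (hα : 2 < α) (hT : 0 ≤ T) {u : Plane}
    {a : ℝ} (ha : 0 < a) (haR : a < R - ‖u‖) :
    condCoverage lam α R σ T u a = ENNReal.ofReal (P₁ lam α R σ T ‖u‖ a) := by
  have hρ := norm_nonneg u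
  have hu : ‖u‖ ≤ R := by linarith
  have hJ := (interfMean_eq_ofReal hα hT hu ha 0).2
  have hpi := Real.pi_pos
  have hmax : ∀ θ, max a (bdryDist R ‖u‖ θ) = bdryDist R ‖u‖ θ := by
    intro θ
    refine max_eq_right (not_lt.1 fun h => ?_)
    have := (bdryDist_lt_iff hρ hu ha θ).1 h
    nlinarith [Real.cos_le_one θ, mul_nonneg hρ ha.le]
  rw [condCoverage_eq_ofReal hlam hT ha.le (intervalIntegral.integral_nonneg (by linarith)
    fun θ _ => radialValue_nonneg hα hT ha.le (ha.le.trans (le_max_left _ _))) hJ, P₁, zero_add]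
  simp_rw [hmax]
  rfl

/-- The circle of radius `a` around the user crosses the cluster boundary at the angles `±Θ`. On
`|θ| ≤ Θ` it runs outside the cluster and rays start at `a`; on the rest they start at `R'`. -/
lemma condCoverage_eq_P₂ {lam α R σ T : ℝ} (hlam : 0 ≤ lam) (hα : 2 < α) (hT : 0 ≤ T) {u : Plane}
    (hu : ‖u‖ ≤ R) {a : ℝ} (ha : 0 < a) (haR : R - ‖u‖ < a) (haR' : a < R + ‖u‖) :
    condCoverage lam α R σ T u a = ENNReal.ofReal (P₂ lam α R σ T ‖u‖ a) := by
  have hρ : 0 < ‖u‖ := by linarith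
  set ρ := ‖u‖
  set Θ := interAngle R ρ a with hΘ
  have hpi := Real.pi_pos
  have hΘ0 : 0 ≤ Θ := sub_nonneg.2 (Real.arccos_le_pi _)
  have hΘpi : Θ ≤ Real.pi := sub_le_self _ (Real.arccos_nonneg _)
  -- The law of cosines at a crossing point. The bounds on `a` are what puts the argument of
  -- `arccos` in `[-1, 1]`.
  have hcos : 2 * ρ * a * Real.cos Θ = R ^ 2 - ρ ^ 2 - a ^ 2 := by
    have hpos : 0 < 2 * a * ρ := by positivity
    rw [hΘ, interAngle, Real.cos_pi_sub, Real.cos_arccos]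
    · field_simp
      ring
    · rw [le_div_iff₀ hpos]; nlinarith
    · rw [div_le_iff₀ hpos]; nlinarith
  obtain ⟨hint, hJ⟩ := interfMean_eq_ofReal hα hT hu ha (-Θ)
  rw [show -Θ + 2 * Real.pi = 2 * Real.pi - Θ by ring] at hint hJ
  have hsplit := intervalIntegral.integral_add_adjacent_intervals
    (hint.mono_set (c := -Θ) (d := Θ) (by
      rw [uIcc_of_le (by linarith), uIcc_of_le (by linarith)]
      exact Icc_subset_Icc le_rfl (by linarith)))
    (hint.mono_set (c := Θ) (d := 2 * Real.pi - Θ) (by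
      rw [uIcc_of_le (by linarith), uIcc_of_le (by linarith)]
      exact Icc_subset_Icc (by linarith) le_rfl))
  have hinner : ∫ θ in (-Θ)..Θ, radialValue α T a (max a (bdryDist R ρ θ)) =
      2 * Θ * (T * a ^ 2 * bigLambda α 1 T / (α - 2)) := by
    have hval : ∀ θ ∈ uIcc (-Θ) Θ, radialValue α T a (max a (bdryDist R ρ θ)) =
        T * a ^ 2 * bigLambda α 1 T / (α - 2) := by
      intro θ hθ
      rw [uIcc_of_le (by linarith)] at hθ
      have hc : Real.cos Θ ≤ Real.cos θ := by
        rw [← Real.cos_abs θ]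
        exact Real.cos_le_cos_of_nonneg_of_le_pi (abs_nonneg _) hΘpi (abs_le.2 hθ)
      have hle : bdryDist R ρ θ ≤ a := by
        rw [bdryDist_le_iff hρ.le hu ha]
        have := mul_le_mul_of_nonneg_left hc (by positivity : 0 ≤ 2 * ρ * a)
        linarith
      rw [max_eq_left hle, radialValue, div_self ha.ne', mul_assoc T, ← Real.rpow_add ha,
        add_sub_cancel, Real.rpow_two]
    rw [intervalIntegral.integral_congr hval, intervalIntegral.integral_const, smul_eq_mul]
    ring
  have houter : ∫ θ in Θ..(2 * Real.pi - Θ), radialValue α T a (max a (bdryDist R ρ θ)) =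
      ∫ θ in Θ..(2 * Real.pi - Θ), angularTerm α R T ρ a θ := by
    refine intervalIntegral.integral_congr fun θ hθ => ?_
    rw [uIcc_of_le (by linarith)] at hθ
    have hc : Real.cos θ ≤ Real.cos Θ := by
      rcases le_total θ Real.pi with h | h
      · exact Real.cos_le_cos_of_nonneg_of_le_pi hΘ0 h hθ.1
      · rw [← Real.cos_two_pi_sub]
        exact Real.cos_le_cos_of_nonneg_of_le_pi hΘ0 (by linarith) (by linarith [hθ.2])
    have hle : a ≤ bdryDist R ρ θ := by
      rw [← not_lt, bdryDist_lt_iff hρ.le hu ha]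
      have := mul_le_mul_of_nonneg_left hc (by positivity : 0 ≤ 2 * ρ * a)
      linarith
    rw [max_eq_right hle]
    rfl
  rw [condCoverage_eq_ofReal hlam hT ha.le (intervalIntegral.integral_nonneg (by linarith)
    fun θ _ => radialValue_nonneg hα hT ha.le (ha.le.trans (le_max_left _ _))) hJ, P₂, ← hsplit,
    hinner, houter, ← hΘ, mul_add, neg_add, Real.exp_add, ← mul_assoc, ← mul_assoc]

/-! ### The laws of the distances -/

lemma measurable_nearestDist {β : Type*} [MeasurableSpace β] {x : β → ℕ → Plane} {u : β → Plane}
    (hx : ∀ n, Measurable fun b => x b n) (hu : Measurable u) :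
    Measurable fun b => nearestDist (x b) (u b) := by
  unfold nearestDist
  exact Measurable.iInf fun n => ((hx n).sub hu).norm

lemma le_nearestDist_iff (x : ℕ → Plane) (u : Plane) (r : ℝ) :
    r ≤ nearestDist x u ↔ ∀ n, r ≤ ‖x n - u‖ :=
  le_ciInf_iff ⟨0, by rintro _ ⟨n, rfl⟩; exact norm_nonneg _⟩

lemma nearestDistLaw_Ici {lam : ℝ} (hlam : 0 < lam) (r : ℝ) :
    nearestDistLaw lam (Ici r) = ENNReal.ofReal (Real.exp (-(lam * Real.pi * (max 0 r) ^ 2))) := by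
  have h1 := lintegral_nearestDistLaw (lam := lam) (φ := (Ici r).indicator fun _ => 1)
    (measurable_const.indicator measurableSet_Ici)
  have hpi := Real.pi_pos
  rw [lintegral_indicator_const measurableSet_Ici, one_mul] at h1
  rw [h1, ← setLIntegral_Ioi_rayleigh (by positivity) (le_max_left 0 r), ← Ioi_inter_Ioi]
  have h2 : ∀ s, ENNReal.ofReal (2 * Real.pi * lam * s * Real.exp (-(lam * Real.pi * s ^ 2))) *
      (Ici r).indicator (fun _ => 1) s = (Ici r).indicator (fun s =>
        ENNReal.ofReal (2 * (lam * Real.pi) * s * Real.exp (-(lam * Real.pi * s ^ 2)))) s := by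
    intro s
    by_cases hs : s ∈ Ici r
    · rw [indicator_of_mem hs, indicator_of_mem hs, mul_one]
      congr 2; ring
    · rw [indicator_of_notMem hs, indicator_of_notMem hs, mul_zero]
  rw [lintegral_congr h2, lintegral_indicator measurableSet_Ici,
    Measure.restrict_restrict measurableSet_Ici, inter_comm]
  exact setLIntegral_congr ((ae_eq_refl _).inter Ioi_ae_eq_Ici.symm)

lemma isProbabilityMeasure_nearestDistLaw {lam : ℝ} (hlam : 0 < lam) :
    IsProbabilityMeasure (nearestDistLaw lam) := by
  have h1 : ∀ r ≤ (0 : ℝ), nearestDistLaw lam (Ici r) = 1 := fun r hr => by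
    rw [nearestDistLaw_Ici hlam, max_eq_left hr]; simp
  have h2 : nearestDistLaw lam (Iio 0) = 0 := by
    rw [nearestDistLaw, withDensity_apply _ measurableSet_Iio]
    refine setLIntegral_eq_zero measurableSet_Iio fun r hr => ?_
    exact indicator_of_notMem (fun h => absurd h (not_le.2 hr)) _
  refine ⟨le_antisymm ?_ ?_⟩
  · rw [← Iio_union_Ici (a := (0 : ℝ))]
    exact (measure_union_le _ _).trans (by rw [h2, h1 0 le_rfl, zero_add])
  · rw [← h1 0 le_rfl]
    exact measure_mono (subset_univ _)

/-- The closed forms hold only for positive serving distance; the remaining case is negligible. -/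
lemma nearestDistLaw_Iic_zero (lam : ℝ) : nearestDistLaw lam (Iic 0) = 0 := by
  rw [nearestDistLaw, withDensity_apply _ measurableSet_Iic, ← setLIntegral_congr Iio_ae_eq_Iic]
  refine setLIntegral_eq_zero measurableSet_Iio fun r hr => ?_
  exact indicator_of_notMem (fun h => absurd h (not_le.2 hr)) _

section

variable {Ω : Type*} [MeasurableSpace Ω] {P : Measure Ω} [IsProbabilityMeasure P]

/-- The nearest point is at distance at least `r` exactly when the open ball of radius `r` is empty,
so the void probabilities determine the law. -/
lemma map_nearestDist {lam : ℝ} (hlam : 0 < lam) {X : ℕ → Ω → Plane}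
    (hX : IsPoissonProcess P lam X) (u : Plane) :
    P.map (fun ω => nearestDist (fun n => X n ω) u) = nearestDistLaw lam := by
  have hm : Measurable fun ω => nearestDist (fun n => X n ω) u :=
    measurable_nearestDist hX.measurable measurable_const
  have := Measure.isProbabilityMeasure_map (μ := P) hm.aemeasurable
  refine Measure.ext_of_Ici _ _ fun r => ?_
  have hset : (fun ω => nearestDist (fun n => X n ω) u) ⁻¹' Ici r =
      {ω | pointCount X (Metric.ball u (max 0 r)) ω = (0 : ℕ)} := by
    ext ω
    simp only [mem_preimage, mem_Ici, le_nearestDist_iff, mem_ofPred_eq, pointCount, Nat.cast_zero,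
      encard_eq_zero, eq_empty_iff_forall_notMem, mem_ball_iff_norm, not_lt, max_le_iff,
      norm_nonneg, true_and]
  have hpi := Real.pi_pos
  rw [Measure.map_apply hm measurableSet_Ici, hset, hX.count_law _ Metric.isOpen_ball.measurableSet
    measure_ball_lt_top.ne, nearestDistLaw_Ici hlam, measureReal_def,
    volume_ball_plane u (le_max_left 0 r), ENNReal.toReal_ofReal (by positivity)]
  simp [mul_assoc]

lemma userDistLaw_Iic {R : ℝ} (hR : 0 < R) (r : ℝ) :
    userDistLaw R (Iic r) = ENNReal.ofReal ((max 0 (min r R)) ^ 2 / R ^ 2) := by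
  have hm : (0 : ℝ) ≤ max 0 (min r R) := le_max_left _ _
  have h := setLIntegral_Ico_linear (c := 1 / R ^ 2) (by positivity) le_rfl hm
  rw [userDistLaw, withDensity_apply _ measurableSet_Iic, lintegral_indicator measurableSet_Icc,
    Measure.restrict_restrict measurableSet_Icc]
  have hset : (Icc 0 R ∩ Iic r : Set ℝ) =ᵐ[volume] Ico 0 (max 0 (min r R)) := by
    have h1 : Icc 0 R ∩ Iic r = Icc 0 (min r R) := by
      ext s; simp only [mem_inter_iff, mem_Icc, mem_Iic, le_min_iff]; tauto
    rw [h1]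
    rcases le_or_gt 0 (min r R) with h0 | h0
    · rw [max_eq_right h0]; exact Ico_ae_eq_Icc.symm
    · rw [max_eq_left h0.le, Icc_eq_empty (not_le.2 h0), Ico_self]; exact ae_eq_refl _
  rw [setLIntegral_congr hset]
  calc _ = ∫⁻ s in Ico 0 (max 0 (min r R)), ENNReal.ofReal (2 * (1 / R ^ 2) * s) := by
        refine lintegral_congr fun s => ?_
        congr 1; ring
    _ = _ := by rw [h]; congr 1; ring

lemma map_norm_of_isUniform {R : ℝ} (hR : 0 < R) {U : Ω → Plane} (hU : Measurable U)
    (hU_law : pdf.IsUniform U (cluster R) P volume) :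
    P.map (fun ω => ‖U ω‖) = userDistLaw R := by
  have := Measure.isProbabilityMeasure_map (μ := P) hU.norm.aemeasurable
  refine Measure.ext_of_Iic _ _ fun r => ?_
  have hvol : ∀ s : ℝ, volume (Metric.closedBall (0 : Plane) s) =
      ENNReal.ofReal (Real.pi * (max 0 s) ^ 2) := by
    intro s
    rw [EuclideanSpace.volume_closedBall_fin_two, mul_comm Real.pi, ENNReal.ofReal_mul (by positivity),
      ENNReal.ofReal_pow (le_max_left 0 s)]
    congr 2
    rcases le_total 0 s with h | h
    · rw [max_eq_right h]
    · rw [max_eq_left h, ENNReal.ofReal_of_nonpos h, ENNReal.ofReal_zero]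
  have hset : cluster R ∩ {u | ‖u‖ ∈ Iic r} = Metric.closedBall 0 (min r R) := by
    ext u
    simp only [cluster, mem_inter_iff, Metric.mem_closedBall, dist_zero_right, mem_ofPred_eq, mem_Iic,
      le_min_iff]
    tauto
  have hmeas : MeasurableSet {u : Plane | ‖u‖ ∈ Iic r} := measurable_norm measurableSet_Iic
  have h1 : P.map (fun ω => ‖U ω‖) (Iic r) = P.map U {u | ‖u‖ ∈ Iic r} := by
    rw [Measure.map_apply hU.norm measurableSet_Iic, Measure.map_apply hU hmeas]; rfl
  have hpi := Real.pi_pos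
  rw [h1, hU_law, cond_apply (measurableSet_cluster R), hset, cluster, hvol, hvol,
    max_eq_right hR.le, ← ENNReal.ofReal_inv_of_pos (by positivity),
    ← ENNReal.ofReal_mul (by positivity), userDistLaw_Iic hR]
  congr 1
  field_simp

end

/-! ### Averaging over the user and the network -/

section

/-! ### Measurability of the coverage event. -/

variable {β : Type*} [MeasurableSpace β] {x : β → ℕ → Plane} {η : β → ℕ → ℂ} {u : β → Plane}

lemma measurable_rxPower (hx : ∀ n, Measurable fun b => x b n) (hη : ∀ n, Measurable fun b => η b n)
    (hu : Measurable u) (α : ℝ) (n : ℕ) : Measurable fun b => rxPower α (x b) (η b) (u b) n :=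
  (((hη n).norm.pow_const 2).mul (((hx n).sub hu).norm.pow_const (-α))).ennreal_ofReal

lemma measurable_interference (hx : ∀ n, Measurable fun b => x b n)
    (hη : ∀ n, Measurable fun b => η b n) (hu : Measurable u) (α R : ℝ) (n : ℕ) :
    Measurable fun b => interference α R (x b) (η b) (u b) n := by
  classical
  unfold interference
  refine Measurable.tsum fun k => Measurable.ite ?_ (measurable_rxPower hx hη hu α k)
    measurable_const
  exact (MeasurableSet.const (k ≠ n)).inter ((hx k) (measurableSet_cluster R).compl)

lemma measurableSet_inCoverage (hx : ∀ n, Measurable fun b => x b n)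
    (hη : ∀ n, Measurable fun b => η b n) (hu : Measurable u) (α R σ T : ℝ) :
    MeasurableSet {b | InCoverage α R σ T (x b) (η b) (u b)} := by
  have hset : {b | InCoverage α R σ T (x b) (η b) (u b)} =
      ⋃ n, (⋂ k, ⋂ (_ : k ≠ n), {b | ‖x b n - u b‖ < ‖x b k - u b‖}) ∩
        {b | ENNReal.ofReal T < sinr α R σ (x b) (η b) (u b) n} := by
    ext b
    simp [InCoverage, IsServing]
  rw [hset]
  refine MeasurableSet.iUnion fun n => MeasurableSet.inter ?_ ?_
  · exact MeasurableSet.iInter fun k => MeasurableSet.iInter fun _ =>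
      measurableSet_lt ((hx n).sub hu).norm ((hx k).sub hu).norm
  · refine measurableSet_lt measurable_const ?_
    unfold sinr
    exact (measurable_rxPower hx hη hu α n).div
      (measurable_const.add (measurable_interference hx hη hu α R n))

end

section

variable {Ω : Type*} [MeasurableSpace Ω] {P : Measure Ω} [IsProbabilityMeasure P]
  {X : ℕ → Ω → Plane} {U : Ω → Plane} {h : ℕ → Ω → ℂ}

/-- The user's location and the distance to the nearest point are independent. -/
lemma map_user_nearestDist {lam : ℝ} (hlam : 0 < lam) (hX : IsPoissonProcess P lam X)
    (hU : Measurable U) (hXU : IndepFun (fun ω n => X n ω) U P) :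
    P.map (fun ω => (U ω, nearestDist (fun n => X n ω) (U ω))) =
      (P.map U).prod (nearestDistLaw lam) := by
  have hXm : Measurable fun ω n => X n ω := measurable_pi_lambda _ hX.measurable
  have hm : Measurable fun ω => nearestDist (fun n => X n ω) (U ω) :=
    measurable_nearestDist hX.measurable hU
  have hm2 : Measurable fun p : (ℕ → Plane) × Plane => nearestDist p.1 p.2 :=
    measurable_nearestDist (fun n => (measurable_pi_apply n).comp measurable_fst) measurable_snd
  have := isProbabilityMeasure_nearestDistLaw hlam
  have := Measure.isProbabilityMeasure_map (μ := P) hU.aemeasurable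
  have := Measure.isProbabilityMeasure_map (μ := P) hXm.aemeasurable
  have hjoint := (indepFun_iff_map_prod_eq_prod_map_map hXm.aemeasurable hU.aemeasurable).1 hXU
  refine (Measure.prod_eq fun s t hs ht => ?_).symm
  have hS : MeasurableSet {p : (ℕ → Plane) × Plane | p.2 ∈ s ∧ nearestDist p.1 p.2 ∈ t} :=
    (measurable_snd hs).inter (hm2 ht)
  have h1 : P.map (fun ω => (U ω, nearestDist (fun n => X n ω) (U ω))) (s ×ˢ t) =
      P.map (fun ω => ((fun n => X n ω), U ω))
        {p : (ℕ → Plane) × Plane | p.2 ∈ s ∧ nearestDist p.1 p.2 ∈ t} := by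
    rw [Measure.map_apply (hU.prodMk hm) (hs.prod ht), Measure.map_apply (hXm.prodMk hU) hS]
    rfl
  -- By stationarity the law of the nearest distance is the same at every `u`, so the slices depend
  -- on `u` only through `s`.
  have h2 : ∀ u, (P.map fun ω n => X n ω)
      ((fun x => (x, u)) ⁻¹' {p : (ℕ → Plane) × Plane | p.2 ∈ s ∧ nearestDist p.1 p.2 ∈ t}) =
      s.indicator (fun _ => nearestDistLaw lam t) u := by
    intro u
    have hmu : Measurable fun x : ℕ → Plane => nearestDist x u :=
      measurable_nearestDist measurable_pi_apply measurable_const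
    by_cases hu : u ∈ s
    · have : (fun x => (x, u)) ⁻¹'
          {p : (ℕ → Plane) × Plane | p.2 ∈ s ∧ nearestDist p.1 p.2 ∈ t} =
          (fun x => nearestDist x u) ⁻¹' t := by
        ext x; simp [hu]
      rw [this, indicator_of_mem hu, ← map_nearestDist hlam hX u, Measure.map_apply hXm (hmu ht),
        Measure.map_apply (measurable_nearestDist hX.measurable measurable_const) ht]
      rfl
    · have : (fun x => (x, u)) ⁻¹'
          {p : (ℕ → Plane) × Plane | p.2 ∈ s ∧ nearestDist p.1 p.2 ∈ t} = ∅ := by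
        ext x; simp [hu]
      rw [this, indicator_of_notMem hu, measure_empty]
  rw [h1, hjoint, Measure.prod_apply_symm hS, lintegral_congr h2, lintegral_indicator_const hs,
    mul_comm]

/-- Independence and Tonelli's theorem allow the user to be frozen on both sides, which reduces the
claim to `lintegral_condCoverage_le`. -/
lemma lintegral_condCoverage_le_prob {lam : ℝ} (hlam : 0 < lam) {α R σ T : ℝ} (hα : 0 < α)
    (hT : 0 < T) (hX : IsPoissonProcess P lam X) (hU : Measurable U) (hh : ∀ n, Measurable (h n))
    (hh_law : ∀ n, P.map (h n) = complexGaussian) (hh_indep : iIndepFun h P)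
    (hXU : IndepFun (fun ω n => X n ω) U P)
    (hXUh : IndepFun (fun ω => ((fun n => X n ω), U ω)) (fun ω n => h n ω) P) :
    ∫⁻ ω, condCoverage lam α R σ T (U ω) (nearestDist (fun n => X n ω) (U ω)) ∂P ≤
      P {ω | InCoverage α R σ T (fun n => X n ω) (fun n => h n ω) (U ω)} := by
  have hXm : Measurable fun ω n => X n ω := measurable_pi_lambda _ hX.measurable
  have hhm : Measurable fun ω n => h n ω := measurable_pi_lambda _ hh
  have hm : Measurable fun ω => nearestDist (fun n => X n ω) (U ω) :=
    measurable_nearestDist hX.measurable hU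
  have := isProbabilityMeasure_nearestDistLaw hlam
  have := Measure.isProbabilityMeasure_map (μ := P) hU.aemeasurable
  have := Measure.isProbabilityMeasure_map (μ := P) hXm.aemeasurable
  have := Measure.isProbabilityMeasure_map (μ := P) hhm.aemeasurable
  have hG : Measurable fun p : Plane × ℝ => condCoverage lam α R σ T p.1 p.2 :=
    measurable_condCoverage lam α R σ T measurable_fst measurable_snd
  have hleft : ∫⁻ ω, condCoverage lam α R σ T (U ω) (nearestDist (fun n => X n ω) (U ω)) ∂P =
      ∫⁻ u, ∫⁻ r, condCoverage lam α R σ T u r ∂(nearestDistLaw lam) ∂(P.map U) := by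
    have h1 := lintegral_map (μ := P) hG (hU.prodMk hm)
    rw [map_user_nearestDist hlam hX hU hXU, lintegral_prod _ hG.aemeasurable] at h1
    exact h1.symm
  let S : Set (((ℕ → Plane) × Plane) × (ℕ → ℂ)) := {q | InCoverage α R σ T q.1.1 q.2 q.1.2}
  have hS : MeasurableSet S := measurableSet_inCoverage
    (fun n => (measurable_pi_apply n).comp (measurable_fst.comp measurable_fst))
    (fun n => (measurable_pi_apply n).comp measurable_snd) (measurable_snd.comp measurable_fst)
    α R σ T
  have hslice : Measurable fun p : (ℕ → Plane) × Plane =>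
      (P.map fun ω n => h n ω) (Prod.mk p ⁻¹' S) := measurable_measure_prodMk_left hS
  have hright : P {ω | InCoverage α R σ T (fun n => X n ω) (fun n => h n ω) (U ω)} =
      ∫⁻ u, ∫⁻ x, (P.map fun ω n => h n ω) (Prod.mk (x, u) ⁻¹' S) ∂(P.map fun ω n => X n ω)
        ∂(P.map U) := by
    have h1 : P {ω | InCoverage α R σ T (fun n => X n ω) (fun n => h n ω) (U ω)} =
        P.map (fun ω => (((fun n => X n ω), U ω), fun n => h n ω)) S := by
      rw [Measure.map_apply ((hXm.prodMk hU).prodMk hhm) hS]; rfl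
    rw [h1, (indepFun_iff_map_prod_eq_prod_map_map (hXm.prodMk hU).aemeasurable
      hhm.aemeasurable).1 hXUh, (indepFun_iff_map_prod_eq_prod_map_map hXm.aemeasurable
      hU.aemeasurable).1 hXU, Measure.prod_apply hS, lintegral_prod_symm _ hslice.aemeasurable]
  rw [hleft, hright]
  refine lintegral_mono fun u => ?_
  refine (lintegral_condCoverage_le hlam hX hh hh_law hh_indep hα hT u).trans_eq ?_
  have hsu : Measurable fun x : ℕ → Plane => (P.map fun ω n => h n ω) (Prod.mk (x, u) ⁻¹' S) :=
    hslice.comp measurable_prodMk_right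
  rw [lintegral_map hsu hXm]
  refine lintegral_congr fun ω => ?_
  rw [Measure.map_apply hhm (measurable_prodMk_left hS)]
  rfl

end

/-! ### The two types of users -/

lemma P₁_nonneg (lam α R σ T ru rb : ℝ) : 0 ≤ P₁ lam α R σ T ru rb := by
  unfold P₁; positivity

lemma P₂_nonneg (lam α R σ T ru rb : ℝ) : 0 ≤ P₂ lam α R σ T ru rb := by
  unfold P₂; positivity

variable {lam α R σ T : ℝ} {u : Plane} {a : ℝ}

lemma typeITerm_eq (hlam : 0 ≤ lam) (hα : 2 < α) (hT : 0 ≤ T) (ha : 0 < a) :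
    typeITerm lam α R σ T ‖u‖ a =
      {p : Plane × ℝ | p.2 < R - ‖p.1‖}.indicator
        (fun p => (condCoverage lam α R σ T p.1 p.2).toReal) (u, a) := by
  by_cases hlt : a < R - ‖u‖
  · rw [indicator_of_mem (by exact hlt), typeITerm, if_pos hlt,
      condCoverage_eq_P₁ hlam hα hT ha hlt, ENNReal.toReal_ofReal (P₁_nonneg _ _ _ _ _ _ _)]
  · rw [indicator_of_notMem (by exact hlt), typeITerm, if_neg hlt]

lemma typeIITerm_eq (hlam : 0 ≤ lam) (hα : 2 < α) (hT : 0 ≤ T) (hu : ‖u‖ ≤ R) (ha : 0 < a) :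
    typeIITerm lam α R σ T ‖u‖ a =
      {p : Plane × ℝ | R - ‖p.1‖ < p.2 ∧ p.2 < R + ‖p.1‖}.indicator
        (fun p => (condCoverage lam α R σ T p.1 p.2).toReal) (u, a) := by
  by_cases hlt : R - ‖u‖ < a ∧ a < R + ‖u‖
  · rw [indicator_of_mem (by exact hlt), typeIITerm, if_pos hlt,
      condCoverage_eq_P₂ hlam hα hT hu ha hlt.1 hlt.2,
      ENNReal.toReal_ofReal (P₂_nonneg _ _ _ _ _ _ _)]
  · rw [indicator_of_notMem (by exact hlt), typeIITerm, if_neg hlt]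

end CloudRadio

end

/-! ### Assembly of the bound. -/

theorem lemma1 {Ω : Type*} [MeasurableSpace Ω] (P : Measure Ω) [IsProbabilityMeasure P]
    (lam α R σ T : ℝ) (hlam : 0 < lam) (hα : 2 < α) (hR : 0 < R) (hT : 0 < T)
    -- the base stations: a Poisson process of intensity `lam`
    (X : ℕ → Ω → CloudRadio.Plane) (hX : CloudRadio.IsPoissonProcess P lam X)
    -- the typical user, uniformly distributed in the cluster
    (U : Ω → CloudRadio.Plane) (hU : Measurable U)
    (hU_law : pdf.IsUniform U (CloudRadio.cluster R) P volume)
    -- Rayleigh fading between the typical user and the base stations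
    (h : ℕ → Ω → ℂ) (hh : ∀ n, Measurable (h n))
    (hh_law : ∀ n, P.map (h n) = CloudRadio.complexGaussian) (hh_indep : iIndepFun h P)
    -- the base stations, the user and the fading are mutually independent
    (hXU : IndepFun (fun ω n => X n ω) U P)
    (hXUh : IndepFun (fun ω => ((fun n => X n ω), U ω)) (fun ω n => h n ω) P) :
    -- the joint law of `r_u` and `r_b`
    P.map (fun ω => (‖U ω‖, CloudRadio.nearestDist (fun n => X n ω) (U ω))) =
        (CloudRadio.userDistLaw R).prod (CloudRadio.nearestDistLaw lam) ∧
      -- the two expectations exist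
      Integrable (fun ω => CloudRadio.typeITerm lam α R σ T ‖U ω‖
        (CloudRadio.nearestDist (fun n => X n ω) (U ω))) P ∧
      Integrable (fun ω => CloudRadio.typeIITerm lam α R σ T ‖U ω‖
        (CloudRadio.nearestDist (fun n => X n ω) (U ω))) P ∧
      -- the bound on the coverage probability
      (∫ ω, CloudRadio.typeITerm lam α R σ T ‖U ω‖
          (CloudRadio.nearestDist (fun n => X n ω) (U ω)) ∂P) +
        (∫ ω, CloudRadio.typeIITerm lam α R σ T ‖U ω‖
          (CloudRadio.nearestDist (fun n => X n ω) (U ω)) ∂P) ≤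
        P.real {ω | CloudRadio.InCoverage α R σ T (fun n => X n ω) (fun n => h n ω) (U ω)} := by
  open CloudRadio in
  set rb : Ω → ℝ := fun ω => nearestDist (fun n => X n ω) (U ω)
  have hm : Measurable rb := measurable_nearestDist hX.measurable hU
  have hprod := map_user_nearestDist hlam hX hU hXU
  have := isProbabilityMeasure_nearestDistLaw hlam
  have := Measure.isProbabilityMeasure_map (μ := P) hU.aemeasurable
  have hlaw : P.map (fun ω => (‖U ω‖, rb ω)) = (userDistLaw R).prod (nearestDistLaw lam) := by
    have h1 : P.map (fun ω => (‖U ω‖, rb ω)) =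
        (P.map fun ω => (U ω, rb ω)).map (Prod.map norm id) := by
      rw [Measure.map_map (measurable_norm.prodMap measurable_id) (hU.prodMk hm)]; rfl
    rw [h1, hprod, ← Measure.map_prod_map _ _ measurable_norm measurable_id, Measure.map_id,
      Measure.map_map measurable_norm hU, ← map_norm_of_isUniform hR hU hU_law]
    rfl
  have hrb : ∀ᵐ ω ∂P, 0 < rb ω := by
    have h1 : P.map rb = nearestDistLaw lam := by
      have h2 : P.map rb = (P.map fun ω => (U ω, rb ω)).map Prod.snd := by
        rw [Measure.map_map measurable_snd (hU.prodMk hm)]; rfl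
      rw [h2, hprod, Measure.map_snd_prod, measure_univ, one_smul]
    have h3 := nearestDistLaw_Iic_zero lam
    rw [← h1, Measure.map_apply hm measurableSet_Iic] at h3
    rw [ae_iff]
    simp only [not_lt]
    exact h3
  have hru : ∀ᵐ ω ∂P, ‖U ω‖ ≤ R := by
    have h1 : P.map U (cluster R)ᶜ = 0 := by
      rw [hU_law, cond_apply (measurableSet_cluster R), inter_compl_self, measure_empty, mul_zero]
    rw [Measure.map_apply hU (measurableSet_cluster R).compl] at h1
    rw [ae_iff, ← h1]
    congr 1
    ext ω
    simp [cluster]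
  set g : Plane × ℝ → ℝ := fun p => (condCoverage lam α R σ T p.1 p.2).toReal with hg
  have hgm : Measurable g := 
    (measurable_condCoverage lam α R σ T measurable_fst measurable_snd).ennreal_toReal
  have hg0 : ∀ p, 0 ≤ g p := fun p => ENNReal.toReal_nonneg
  have hg1 : ∀ p, g p ≤ 1 := fun p => by
    simpa using ENNReal.toReal_mono ENNReal.one_ne_top (condCoverage_le_one lam α R σ T p.1 p.2)
  set A : Set (Plane × ℝ) := {p | p.2 < R - ‖p.1‖} with hA
  set B : Set (Plane × ℝ) := {p | R - ‖p.1‖ < p.2 ∧ p.2 < R + ‖p.1‖} with hB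
  have hAm : MeasurableSet A :=
    measurableSet_lt measurable_snd (measurable_const.sub measurable_fst.norm)
  have hBm : MeasurableSet B :=
    (measurableSet_lt (measurable_const.sub measurable_fst.norm) measurable_snd).inter
      (measurableSet_lt measurable_snd (measurable_const.add measurable_fst.norm))
  have hint : ∀ S, MeasurableSet S → Integrable (fun ω => S.indicator g (U ω, rb ω)) P := by
    intro S hS
    refine Integrable.of_bound
      ((hgm.indicator hS).comp (hU.prodMk hm)).aestronglyMeasurable 1
      (Filter.Eventually.of_forall fun ω => ?_)
    rw [Real.norm_of_nonneg (indicator_nonneg (fun p _ => hg0 p) _)]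
    exact (indicator_le_self' (fun p _ => hg0 p) _).trans (hg1 _)
  have hI : (fun ω => typeITerm lam α R σ T ‖U ω‖ (rb ω)) =ᵐ[P]
      fun ω => A.indicator g (U ω, rb ω) := by
    filter_upwards [hrb] with ω hω
    exact typeITerm_eq hlam.le hα hT.le hω
  have hII : (fun ω => typeIITerm lam α R σ T ‖U ω‖ (rb ω)) =ᵐ[P]
      fun ω => B.indicator g (U ω, rb ω) := by
    filter_upwards [hrb, hru] with ω hω hω'
    exact typeIITerm_eq hlam.le hα hT.le hω' hω
  refine ⟨hlaw, (hint A hAm).congr hI.symm, (hint B hBm).congr hII.symm, ?_⟩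
  -- The two regimes are disjoint, so both terms together are at most `condCoverage`. Outside them
  -- the latter is only bounded below by zero.
  have hdisj : Disjoint A B := Set.disjoint_left.2 fun p hp hp' => lt_asymm hp hp'.1
  rw [integral_congr_ae hI, integral_congr_ae hII, ← integral_add (hint A hAm) (hint B hBm)]
  have hle : ∀ ω, A.indicator g (U ω, rb ω) + B.indicator g (U ω, rb ω) ≤ g (U ω, rb ω) := by
    intro ω
    rw [← Pi.add_apply (A.indicator g), show A.indicator g + B.indicator g =
      fun p => A.indicator g p + B.indicator g p from rfl, ← indicator_union_of_disjoint hdisj g]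
    exact indicator_le_self' (fun p _ => hg0 p) _
  have hgint : Integrable (fun ω => g (U ω, rb ω)) P := by
    simpa using hint univ MeasurableSet.univ
  refine (integral_mono ((hint A hAm).add (hint B hBm)) hgint hle).trans ?_
  have hGm : Measurable fun ω => condCoverage lam α R σ T (U ω) (rb ω) :=
    measurable_condCoverage lam α R σ T hU hm
  rw [integral_toReal hGm.aemeasurable (Filter.Eventually.of_forall fun ω =>
    (condCoverage_le_one lam α R σ T _ _).trans_lt ENNReal.one_lt_top)]
  exact ENNReal.toReal_mono (measure_ne_top P _)
    (lintegral_condCoverage_le_prob hlam (by linarith) hT hX hU hh hh_law hh_indep hXU hXUh)
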